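/- Let $d\ge 1$ and $T\ge 0$ be integers, let $\lambda>0$ with $2\lambda^2>1$, and let $\delta\in(0,1)$. Let $\mathcal S^{d-1}$ be the Euclidean unit sphere of $\mathbb R^d$ and $\mathcal P$ the uniform probability measure on it. Let $W\sim\mathrm{GOE}(d)$: $W$ is a random symmetric $d\times d$ matrix whose entries on and above the diagonal are independent, with $W_{ii}\sim\mathcal N(0,2)$ and $W_{ij}\sim\mathcal N(0,1)$ for $i<j$. For $u\in\mathcal S^{d-1}$ put $M=\lambda uu^{\top}+\frac1{\sqrt d}W$. Consider any (possibly randomized) adaptive query algorithm with $T$ queries: in rounds $k=1,\dots,T$ it queries a unit vector $v^{(k)}$ and receives $w^{(k)}=Mv^{(k)}$, and it finally outputs a unit vector $\widehat v=v^{(T+1)}$; for every $k\le T+1$, $v^{(k)}$ is a measurable function of $(v^{(1)},w^{(1)}),\dots,(v^{(k-1)},w^{(k-1)})$ and of a random seed that is independent of $M$. Let $\mathbf{Pr}_u$ be the joint law of $M$ and the seed (hence of the whole run) when the spike is $u$. Then $$\mathbb E_{\theta\sim\mathcal P}\,\mathbf{Pr}_\theta\Big[\exists k\in\{1,\dots,T+1\}:\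 \langle v^{(k)},\theta\rangle^2\ \ge\ \big(2\lambda^2c(\delta,\lambda)\big)^{k-1}\cdot\frac{2\big(\sqrt{\log(1/\delta)}+1\big)^2}{d}\Big]\ \le\ \frac{2\delta}{1-\delta},$$ where $$c(\delta,\lambda)=\Big(1+\frac1{\lambda^2}\Big)\Big\{\Big(1-\frac1{2\lambda^2}\Big)\Big(1-\sqrt{\tfrac1{1+\log(1/\delta)}}\Big)\Big\}^{-1}.$$ Moreover $c(\delta,\lambda)=1+o(1/\lambda)+r(\delta)$ as $(\delta,\lambda)\to(0^+,\infty)$, for some function $r$ of $\delta$ alone with $r(\delta)\to0$ as $\delta\to0^+$. -/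

import Mathlib

open MeasureTheory ProbabilityTheory Filter Topology Asymptotics

noncomputable section

namespace SpikedQuery

/-- The unit sphere of `ℝ^d`. -/
abbrev Sphere (d : ℕ) : Type :=
  Metric.sphere (0 : EuclideanSpace ℝ (Fin d)) 1

/-- The uniform probability measure on the unit sphere: normalized surface measure. -/
def uniformSphere (d : ℕ) : Measure (Sphere d) :=
  ((volume : Measure (EuclideanSpace ℝ (Fin d))).toSphere Set.univ)⁻¹ •
    (volume : Measure (EuclideanSpace ℝ (Fin d))).toSphere

/-- Matrices carry the product Borel structure of their entries. -/
instance matrixMeasurableSpace (d : ℕ) : MeasurableSpace (Matrix (Fin d) (Fin d) ℝ) :=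
  inferInstanceAs (MeasurableSpace (Fin d → Fin d → ℝ))

/-- Positions on or above the diagonal. -/
abbrev UpperIndex (d : ℕ) : Type := {p : Fin d × Fin d // p.1 ≤ p.2}

/-- The symmetric matrix with prescribed entries on and above the diagonal. -/
def symmetricOfUpper {d : ℕ} (x : UpperIndex d → ℝ) : Matrix (Fin d) (Fin d) ℝ :=
  Matrix.of fun i j => x ⟨(min i j, max i j), min_le_max⟩

/-- The law `GOE(d)`: symmetric matrices whose entries on and above the diagonal are independent
centered Gaussians, of variance `2` on the diagonal and `1` above it. -/
def goe (d : ℕ) : Measure (Matrix (Fin d) (Fin d) ℝ) :=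
  (Measure.pi fun p : UpperIndex d =>
    gaussianReal 0 (if p.1.1 = p.1.2 then 2 else 1)).map symmetricOfUpper

/-- The law of `M = lam • u uᵀ + d^{-1/2} W` with `W ∼ GOE(d)`, i.e. the law of the deformed Wigner
matrix conditioned on the spike being `u`. -/
def spikedLaw (d : ℕ) (lam : ℝ) (u : Sphere d) : Measure (Matrix (Fin d) (Fin d) ℝ) :=
  (goe d).map fun W => lam • Matrix.vecMulVec u.1 u.1 + (Real.sqrt d)⁻¹ • W

/-- A randomized adaptive query algorithm with `T` queries and random seed in `Ξ`. Rounds are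
numbered from `0`: rounds `0, …, T - 1` are the queries and round `T` is the output. The vector of
round `k` is a unit vector, a measurable function of the seed and of the `k` previous
query-response pairs. -/
structure QueryAlgorithm (d T : ℕ) (Ξ : Type*) [MeasurableSpace Ξ] where
  next : (k : Fin (T + 1)) → Ξ →
    (Fin k → EuclideanSpace ℝ (Fin d) × EuclideanSpace ℝ (Fin d)) → Sphere d
  measurable_next : ∀ k : Fin (T + 1), Measurable
    fun p : Ξ × (Fin k → EuclideanSpace ℝ (Fin d) × EuclideanSpace ℝ (Fin d)) => next k p.1 p.2

namespace QueryAlgorithm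

variable {d T : ℕ} {Ξ : Type*} [MeasurableSpace Ξ]

/-- The first `k` query-response pairs `(v, M v)` of a run on the matrix `M` with seed `ξ`. -/
def history (A : QueryAlgorithm d T Ξ) (M : Matrix (Fin d) (Fin d) ℝ) (ξ : Ξ) :
    (k : ℕ) → k ≤ T → (Fin k → EuclideanSpace ℝ (Fin d) × EuclideanSpace ℝ (Fin d))
  | 0, _ => Fin.elim0
  | k + 1, h =>
    let past := history A M ξ k (Nat.le_of_succ_le h)
    let v : EuclideanSpace ℝ (Fin d) := (A.next ⟨k, Nat.lt_succ_of_lt h⟩ ξ past).1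
    Fin.snoc (α := fun _ => EuclideanSpace ℝ (Fin d) × EuclideanSpace ℝ (Fin d))
      past (v, WithLp.toLp 2 (Matrix.mulVec M v))

/-- The vector of round `k` (a query for `k < T`, the output for `k = T`) of a run on the matrix
`M` with seed `ξ`. -/
def vec (A : QueryAlgorithm d T Ξ) (M : Matrix (Fin d) (Fin d) ℝ) (ξ : Ξ) (k : Fin (T + 1)) :
    EuclideanSpace ℝ (Fin d) :=
  (A.next k ξ (A.history M ξ k (Nat.le_of_lt_succ k.2))).1

end QueryAlgorithm

/-- The constant `c(δ, lam)`. -/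
def growthConst (δ lam : ℝ) : ℝ :=
  (1 + 1 / lam ^ 2) *
    ((1 - 1 / (2 * lam ^ 2)) * (1 - Real.sqrt (1 / (1 + Real.log (1 / δ)))))⁻¹

end SpikedQuery

end

/-! The potential is the squared norm of the projection of the spike `θ` onto the span of the
vectors seen so far, i.e. `1 - θᵀQθ` with `Q` the projection onto the complement of that span. It
dominates each squared overlap. Thresholds `τ_k` grow by the factor `q = 2λ²c` per round. If some
overlap exceeds its threshold, then in some round `k` the potential jumps from below `τ_{k-1}` to at
least `τ_k` (`exists_mem_jumpSet`); it remains to sum the jump probabilities over rounds.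

Without a spike in the matrix, the run is independent of `θ`, so a jump requires a uniform `θ` to be
close to a fixed span of `k + 1` vectors (rounds count from `0`). The tail comes from the exact
formula `∫ ‖Bθ‖^{-d} = 1/|det B|` on the sphere, with `B` contracting that span
(`lintegral_exp_uniformSphere_le`, `uniformSphere_tail`).

To return to the spiked law, one computes the likelihood ratio of the history. Given `k` queries,
the block `QWQ` is still a fresh GOE block, although `Q` is chosen adaptively
(`lintegral_goe_eq_resample_blind`). Averaging the Gaussian shift density over that block leaves a
ratio whose quadratic term involves only `1 - (θᵀQθ)²` (`lintegral_history_add_spike`). Its `p`-th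
power is the ratio for the spike `p s` times an exponential of that quantity, which is below
`2τ_{k-1}` before a jump. Hölder restricted to the jump event then costs only
`exp((p-1)s²τ_{k-1}/2)` and raises the unspiked probability to the power `1 - 1/p`
(`lintegral_spiked_history_le`). With `s = λ√d` and `p = 1 + 1/λ²`, the constant `c(δ,λ)` makes the
jump at round `k ≥ 1` have probability at most `δ^k`; round `0` contributes at most `δ`. -/

noncomputable section

namespace SpikedQuery

open Matrix

/-! ### Projections onto complements of spans, built one vector at a time. -/

section Deflation

variable {d : ℕ}

/-- Remove from the orthogonal projection `Q` the direction `Q v`. -/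
def deflate (Q : Matrix (Fin d) (Fin d) ℝ) (v : Fin d → ℝ) : Matrix (Fin d) (Fin d) ℝ :=
  Q - (v ⬝ᵥ Q *ᵥ v)⁻¹ • vecMulVec (Q *ᵥ v) (Q *ᵥ v)

/-- The orthogonal projection onto the complement of the span of `k` vectors. -/
def residual : (k : ℕ) → (Fin k → Fin d → ℝ) → Matrix (Fin d) (Fin d) ℝ
  | 0, _ => 1
  | k + 1, x => deflate (residual k fun i => x i.castSucc) (x (Fin.last k))

/-- Being the matrix of an orthogonal projection. -/
structure IsOrthProj (Q : Matrix (Fin d) (Fin d) ℝ) : Prop where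
  symm : Qᵀ = Q
  idem : Q * Q = Q

namespace IsOrthProj

variable {Q : Matrix (Fin d) (Fin d) ℝ} (hQ : IsOrthProj Q)
include hQ

theorem mulVec_mulVec (v : Fin d → ℝ) : Q *ᵥ (Q *ᵥ v) = Q *ᵥ v := by
  rw [Matrix.mulVec_mulVec, hQ.idem]

theorem dotProduct_mulVec_comm (v w : Fin d → ℝ) : v ⬝ᵥ Q *ᵥ w = (Q *ᵥ v) ⬝ᵥ w := by
  rw [Matrix.dotProduct_mulVec, ← Matrix.mulVec_transpose, hQ.symm]

theorem dotProduct_self (v : Fin d → ℝ) : v ⬝ᵥ Q *ᵥ v = (Q *ᵥ v) ⬝ᵥ (Q *ᵥ v) := by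
  rw [← hQ.dotProduct_mulVec_comm, hQ.mulVec_mulVec]

theorem dotProduct_nonneg (v : Fin d → ℝ) : 0 ≤ v ⬝ᵥ Q *ᵥ v := by
  rw [hQ.dotProduct_self]
  exact Finset.sum_nonneg fun i _ => mul_self_nonneg _

theorem one_sub : IsOrthProj (1 - Q) where
  symm := by rw [transpose_sub, transpose_one, hQ.symm]
  idem := by rw [sub_mul, mul_sub, mul_sub, hQ.idem]; simp

theorem deflate (v : Fin d → ℝ) : IsOrthProj (deflate Q v) where
  symm := by
    rw [SpikedQuery.deflate, transpose_sub, transpose_smul, transpose_vecMulVec, hQ.symm]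
  idem := by
    have h : (Q *ᵥ v) ᵥ* Q = Q *ᵥ v := by
      rw [← mulVec_transpose, hQ.symm, hQ.mulVec_mulVec]
    rw [SpikedQuery.deflate, sub_mul, mul_sub, mul_sub, hQ.idem, smul_mul_assoc, mul_smul_comm,
      mul_vecMulVec, hQ.mulVec_mulVec, vecMulVec_mul, h, smul_mul_assoc, mul_smul_comm,
      vecMulVec_mul_vecMulVec, ← hQ.dotProduct_self]
    rcases eq_or_ne (v ⬝ᵥ Q *ᵥ v) 0 with h0 | h0
    · simp [h0]
    · simp [vecMulVec_smul, smul_smul, h0]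

theorem mul_deflate (v : Fin d → ℝ) : Q * SpikedQuery.deflate Q v = SpikedQuery.deflate Q v := by
  rw [SpikedQuery.deflate, mul_sub, hQ.idem, mul_smul_comm, mul_vecMulVec, hQ.mulVec_mulVec]

theorem deflate_mul (v : Fin d → ℝ) : SpikedQuery.deflate Q v * Q = SpikedQuery.deflate Q v := by
  have h := congrArg transpose (hQ.mul_deflate v)
  rwa [transpose_mul, hQ.symm, (hQ.deflate v).symm] at h

theorem deflate_mulVec (v : Fin d → ℝ) : SpikedQuery.deflate Q v *ᵥ v = 0 := by
  rw [SpikedQuery.deflate, sub_mulVec, smul_mulVec, vecMulVec_mulVec,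
    ← hQ.dotProduct_mulVec_comm]
  -- When `v` already lies in the removed span, `0⁻¹ = 0` makes the deflation trivial, and `Q v = 0`
  -- holds already.
  rcases eq_or_ne (v ⬝ᵥ Q *ᵥ v) 0 with h0 | h0
  · have h1 := h0
    rw [hQ.dotProduct_self, dotProduct_self_eq_zero] at h1
    simp [h1]
  · ext i
    simp
    field_simp
    simp

/-- Cauchy–Schwarz, after moving `1 - Q`, which fixes `v`, onto `θ`. -/
theorem sq_dotProduct_le {v θ : Fin d → ℝ} (hv : Q *ᵥ v = 0) (hv1 : v ⬝ᵥ v = 1) :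
    (v ⬝ᵥ θ) ^ 2 ≤ θ ⬝ᵥ θ - θ ⬝ᵥ Q *ᵥ θ := by
  have h1 : v ⬝ᵥ θ = v ⬝ᵥ (1 - Q) *ᵥ θ := by
    rw [hQ.one_sub.dotProduct_mulVec_comm, sub_mulVec, one_mulVec, hv, sub_zero]
  have h2 : θ ⬝ᵥ θ - θ ⬝ᵥ Q *ᵥ θ = ((1 - Q) *ᵥ θ) ⬝ᵥ ((1 - Q) *ᵥ θ) := by
    rw [← hQ.one_sub.dotProduct_self, sub_mulVec, one_mulVec, dotProduct_sub]
  rw [h1, h2]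
  have := Finset.sum_mul_sq_le_sq_mul_sq Finset.univ v ((1 - Q) *ᵥ θ)
  simp only [dotProduct] at hv1 ⊢
  calc _ ≤ _ := this
    _ = _ := by simp only [pow_two, hv1, one_mul]

/-- A rank-one update: `1 - c(1 - Q)` fixes `Q v`, so it factors out on the left and the matrix
determinant lemma applies. The second factor is `1` if `v` is dependent on the removed vectors and
`1 - c` otherwise. -/
theorem det_deflate (v : Fin d → ℝ) (c : ℝ) :
    (1 - c • (1 - SpikedQuery.deflate Q v)).det =
      (1 - c • (1 - Q)).det * (1 - c * ((v ⬝ᵥ Q *ᵥ v)⁻¹ * (v ⬝ᵥ Q *ᵥ v))) := by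
  have h : 1 - c • (1 - SpikedQuery.deflate Q v) = (1 - c • (1 - Q)) *
      (1 + replicateCol Unit (-(c * (v ⬝ᵥ Q *ᵥ v)⁻¹) • (Q *ᵥ v)) * replicateRow Unit (Q *ᵥ v)) := by
    rw [← vecMulVec_eq, mul_add, mul_one, mul_vecMulVec, mulVec_smul, sub_mulVec, one_mulVec,
      smul_mulVec, sub_mulVec, one_mulVec, hQ.mulVec_mulVec, SpikedQuery.deflate]
    simp only [smul_vecMulVec, sub_self, smul_zero, sub_zero]
    module
  rw [h, det_mul, det_one_add_replicateCol_mul_replicateRow, dotProduct_smul,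
    ← hQ.dotProduct_self, smul_eq_mul]
  ring

end IsOrthProj

theorem isOrthProj_residual (k : ℕ) (x : Fin k → Fin d → ℝ) : IsOrthProj (residual k x) := by
  induction k with
  | zero => exact ⟨transpose_one, one_mul _⟩
  | succ k ih => exact (ih _).deflate _

theorem residual_mulVec (k : ℕ) (x : Fin k → Fin d → ℝ) (i : Fin k) :
    residual k x *ᵥ x i = 0 := by
  induction k with
  | zero => exact i.elim0
  | succ k ih =>
    refine Fin.lastCases ?_ (fun j => ?_) i
    · exact (isOrthProj_residual k _).deflate_mulVec _
    · rw [residual, ← (isOrthProj_residual k _).deflate_mul, ← mulVec_mulVec,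
        ih (fun i => x i.castSucc) j, mulVec_zero]

/-- The determinant is `(1 - c)` to the dimension of the span; only an inequality holds, since the
`k` vectors may be dependent. -/
theorem le_det_one_sub_residual {c : ℝ} (h0 : 0 ≤ c) (h1 : c ≤ 1) (k : ℕ)
    (x : Fin k → Fin d → ℝ) : (1 - c) ^ k ≤ (1 - c • (1 - residual k x)).det := by
  induction k with
  | zero => simp [residual]
  | succ k ih =>
    rw [residual, (isOrthProj_residual k _).det_deflate, pow_succ]
    have h2 : 0 ≤ 1 - c := by linarith
    refine mul_le_mul (ih _) ?_ h2 ((pow_nonneg h2 k).trans (ih _))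
    generalize (x (Fin.last k) ⬝ᵥ _ : ℝ) = t
    rcases eq_or_ne t 0 with rfl | ht
    · simpa using h0
    · rw [inv_mul_cancel₀ ht, mul_one]

theorem IsOrthProj.norm_sq_one_sub_smul {Q : Matrix (Fin d) (Fin d) ℝ} (hQ : IsOrthProj Q)
    (c : ℝ) (θ : Fin d → ℝ) :
    ((1 - c • (1 - Q)) *ᵥ θ) ⬝ᵥ ((1 - c • (1 - Q)) *ᵥ θ) =
      θ ⬝ᵥ θ - (2 * c - c ^ 2) * (θ ⬝ᵥ θ - θ ⬝ᵥ Q *ᵥ θ) := by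
  have h2 : ((1 - Q) *ᵥ θ) ⬝ᵥ ((1 - Q) *ᵥ θ) = θ ⬝ᵥ θ - θ ⬝ᵥ Q *ᵥ θ := by
    rw [← hQ.one_sub.dotProduct_self, sub_mulVec, one_mulVec, dotProduct_sub]
  have h3 : θ ⬝ᵥ ((1 - Q) *ᵥ θ) = θ ⬝ᵥ θ - θ ⬝ᵥ Q *ᵥ θ := by
    rw [sub_mulVec, one_mulVec, dotProduct_sub]
  rw [sub_mulVec (1 : Matrix (Fin d) (Fin d) ℝ), one_mulVec, smul_mulVec, dotProduct_sub,
    sub_dotProduct, sub_dotProduct, smul_dotProduct, dotProduct_smul, smul_dotProduct,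
    dotProduct_smul, h2, h3, dotProduct_comm ((1 - Q) *ᵥ θ) θ, h3]
  simp only [smul_eq_mul]
  ring

end Deflation

/-! ### Uniform measure on the sphere: tail of the projection onto a span. -/

section Sphere

open Metric Set

/-- The volume of the ellipsoid `f⁻¹(ball)` is computed twice: by change of variables, and in polar
coordinates, where its radius in direction `θ` is `1/‖f θ‖`. -/
theorem lintegral_sphere_norm_map {E : Type*} [NormedAddCommGroup E] [NormedSpace ℝ E]
    [FiniteDimensional ℝ E] [MeasurableSpace E] [BorelSpace E] (μ : Measure E)
    [μ.IsAddHaarMeasure] [Nontrivial E] {f : E →ₗ[ℝ] E} (hf : LinearMap.det f ≠ 0) :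
    ∫⁻ θ : sphere (0 : E) 1, ENNReal.ofReal ((‖f θ‖ ^ Module.finrank ℝ E)⁻¹) ∂μ.toSphere =
      ENNReal.ofReal |(LinearMap.det f)⁻¹| * μ.toSphere univ := by
  set n := Module.finrank ℝ E with hn
  have hn0 : 0 < n := Module.finrank_pos
  have hfc : Continuous f := f.continuous_of_finiteDimensional
  have hinj : Function.Injective f := by
    have := (LinearMap.equivOfDetNeZero f hf).injective
    exact this
  have hpos : ∀ θ : sphere (0 : E) 1, 0 < ‖f θ‖ := fun θ => by
    rw [norm_pos_iff]
    intro h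
    have h2 : (θ : E) = 0 := hinj (by rw [h, map_zero])
    have h3 := norm_eq_of_mem_sphere θ
    rw [h2, norm_zero] at h3
    exact zero_ne_one h3
  have h1 : μ (f ⁻¹' ball 0 1) = ENNReal.ofReal |(LinearMap.det f)⁻¹| * μ (ball 0 1) :=
    Measure.addHaar_preimage_linearMap μ hf _
  have hmeas : MeasurableSet (f ⁻¹' ball 0 1) := (isOpen_ball.preimage hfc).measurableSet
  have h2 : μ (f ⁻¹' ball 0 1) = ∫⁻ θ : sphere (0 : E) 1,
      Measure.volumeIoiPow (n - 1) (Iio ⟨‖f θ‖⁻¹, inv_pos.2 (hpos θ)⟩) ∂μ.toSphere := by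
    have h3 : μ (f ⁻¹' ball 0 1) = (μ.comap ((↑) : ({0}ᶜ : Set E) → E))
        ((↑) ⁻¹' (f ⁻¹' ball 0 1)) := by
      rw [comap_subtype_coe_apply (measurableSet_singleton _).compl,
        Subtype.image_preimage_coe, inter_comm, ← sdiff_eq,
        measure_sdiff_null (measure_singleton _)]
    have hT : MeasurableSet {p : sphere (0 : E) 1 × Ioi (0 : ℝ) | ‖f (p.2.1 • p.1.1)‖ < 1} := by
      refine (isOpen_lt ?_ continuous_const).measurableSet
      exact (hfc.comp (by fun_prop)).norm
    have h4 : ((↑) ⁻¹' (f ⁻¹' ball 0 1) : Set ({0}ᶜ : Set E)) = (homeomorphUnitSphereProd E) ⁻¹'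
        {p : sphere (0 : E) 1 × Ioi (0 : ℝ) | ‖f (p.2.1 • p.1.1)‖ < 1} := by
      ext x
      have : ‖(x : E)‖ ≠ 0 := norm_ne_zero_iff.2 x.2
      simp [smul_smul, this]
    rw [h3, h4, (μ.measurePreserving_homeomorphUnitSphereProd).measure_preimage
      hT.nullMeasurableSet, Measure.prod_apply hT]
    refine lintegral_congr fun θ => congrArg _ ?_
    ext r
    have hr : 0 < (r : ℝ) := r.2
    simp only [mem_preimage, mem_ofPred_eq, map_smul, norm_smul, Real.norm_eq_abs, abs_of_pos hr,
      mem_Iio, ← Subtype.coe_lt_coe]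
    rw [← one_div, lt_div_iff₀ (hpos θ)]
  have h5 : ∀ θ : sphere (0 : E) 1, ENNReal.ofReal ((‖f θ‖ ^ n)⁻¹) = (n : ENNReal) *
      Measure.volumeIoiPow (n - 1) (Iio ⟨‖f θ‖⁻¹, inv_pos.2 (hpos θ)⟩) := fun θ => by
    rw [Measure.volumeIoiPow_apply_Iio, ← ENNReal.ofReal_natCast,
      ← ENNReal.ofReal_mul (by positivity),
      Nat.sub_add_cancel hn0, Nat.cast_pred hn0, sub_add_cancel, inv_pow, mul_div_cancel₀]
    exact_mod_cast hn0.ne'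
  simp only [h5]
  rw [lintegral_const_mul' _ _ (ENNReal.natCast_ne_top _), ← h2, h1, Measure.toSphere_apply_univ]
  ring

theorem lintegral_uniformSphere_norm_mulVec {d : ℕ} (hd : 1 ≤ d) {B : Matrix (Fin d) (Fin d) ℝ}
    (hB : B.det ≠ 0) :
    ∫⁻ θ : Sphere d, ENNReal.ofReal ((√((B *ᵥ θ.1) ⬝ᵥ (B *ᵥ θ.1)) ^ d)⁻¹) ∂uniformSphere d =
      ENNReal.ofReal |B.det⁻¹| := by
  have : Nonempty (Fin d) := ⟨⟨0, hd⟩⟩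
  have hdet : LinearMap.det (Matrix.toEuclideanLin B) = B.det := by
    rw [Matrix.toEuclideanLin_eq_toLin_orthonormal, LinearMap.det_toLin]
  have h := lintegral_sphere_norm_map (volume : Measure (EuclideanSpace ℝ (Fin d)))
    (f := Matrix.toEuclideanLin B) (by rwa [hdet])
  rw [hdet, finrank_euclideanSpace_fin] at h
  have h0 : (volume : Measure (EuclideanSpace ℝ (Fin d))).toSphere univ ≠ 0 :=
    (Measure.measure_univ_ne_zero).2 (Measure.toSphere_ne_zero _)
  have h1 : ∀ θ : Sphere d, ‖Matrix.toEuclideanLin B θ‖ = √((B *ᵥ θ.1) ⬝ᵥ (B *ᵥ θ.1)) := by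
    intro θ
    rw [EuclideanSpace.norm_eq]
    simp [dotProduct, pow_two]
  simp only [h1] at h
  rw [uniformSphere, lintegral_smul_measure, h, smul_eq_mul, mul_comm, mul_assoc,
    ENNReal.mul_inv_cancel h0 (measure_ne_top _ _), mul_one]

instance isProbabilityMeasure_uniformSphere {d : ℕ} [NeZero d] :
    IsProbabilityMeasure (uniformSphere d) := by
  have : Nonempty (Fin d) := ⟨0⟩
  constructor
  rw [uniformSphere, Measure.smul_apply, smul_eq_mul, ENNReal.inv_mul_cancel
    ((Measure.measure_univ_ne_zero).2 (Measure.toSphere_ne_zero _)) (measure_ne_top _ _)]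

theorem Sphere.dotProduct_self {d : ℕ} (θ : Sphere d) : θ.1.ofLp ⬝ᵥ θ.1.ofLp = 1 := by
  have h := norm_eq_of_mem_sphere θ
  rw [EuclideanSpace.norm_eq, Real.sqrt_eq_one] at h
  simpa [dotProduct, pow_two] using h

theorem exp_half_mul_le_inv_sqrt_pow (d : ℕ) {t : ℝ} (ht : t < 1) :
    Real.exp (d * t / 2) ≤ (√(1 - t) ^ d)⁻¹ := by
  have h1 : √(1 - t) ≤ Real.exp (-t / 2) := by
    rw [Real.sqrt_le_left (Real.exp_pos _).le, ← Real.exp_nat_mul]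
    have := Real.add_one_le_exp (-t)
    calc 1 - t ≤ Real.exp (-t) := by linarith
      _ = _ := by congr 1; push_cast; ring
  calc Real.exp (d * t / 2) = (Real.exp (-t / 2) ^ d)⁻¹ := by
        rw [← Real.exp_nat_mul, ← Real.exp_neg]; congr 1; ring
    _ ≤ _ := by
        have : 0 < √(1 - t) := Real.sqrt_pos.2 (by linarith)
        gcongr

/-- Apply the determinant formula to `B = 1 - c(1 - Q)`: then `‖Bθ‖² = 1 - β(1 - θᵀQθ)`, and `1 - t
≤ exp(-t)` compares the exponential with `‖Bθ‖^{-d}`. -/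
theorem lintegral_exp_uniformSphere_le {d : ℕ} (hd : 1 ≤ d) {β : ℝ} (h0 : 0 ≤ β) (h1 : β < 1)
    (k : ℕ) (x : Fin k → Fin d → ℝ) :
    ∫⁻ θ : Sphere d, ENNReal.ofReal
        (Real.exp (d * (β * (1 - θ.1.ofLp ⬝ᵥ residual k x *ᵥ θ.1.ofLp)) / 2)) ∂uniformSphere d ≤
      ENNReal.ofReal ((√(1 - β) ^ k)⁻¹) := by
  set c := 1 - √(1 - β) with hc
  -- The choice of `c` amounts to `(1 - c)² = 1 - β`.
  have hs0 : 0 < √(1 - β) := Real.sqrt_pos.2 (by linarith)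
  have hs1 : √(1 - β) ≤ 1 := Real.sqrt_le_one.2 (by linarith)
  have hβ : 2 * c - c ^ 2 = β := by
    have := Real.sq_sqrt (show (0 : ℝ) ≤ 1 - β by linarith)
    rw [hc]; linarith
  have hdet := le_det_one_sub_residual (show 0 ≤ c by linarith) (show c ≤ 1 by linarith) k x
  have hpos : 0 < (1 - c) ^ k := pow_pos (by linarith) k
  have hQ := isOrthProj_residual k x
  have h := lintegral_uniformSphere_norm_mulVec hd (hpos.trans_le hdet).ne'
  calc _ ≤ _ := lintegral_mono fun θ => ENNReal.ofReal_le_ofReal ?_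
    _ = _ := h
    _ ≤ _ := ?_
  · rw [hQ.norm_sq_one_sub_smul, Sphere.dotProduct_self, hβ]
    apply exp_half_mul_le_inv_sqrt_pow
    have := hQ.dotProduct_nonneg θ.1.ofLp
    nlinarith
  · refine ENNReal.ofReal_le_ofReal ?_
    rw [abs_of_pos (inv_pos.2 (hpos.trans_le hdet)), show √(1 - β) = 1 - c by rw [hc]; ring]
    gcongr

theorem uniformSphere_tail {d : ℕ} (hd : 1 ≤ d) {β : ℝ} (h0 : 0 ≤ β) (h1 : β < 1) (a : ℝ)
    (k : ℕ) (x : Fin k → Fin d → ℝ) :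
    uniformSphere d {θ | 2 * a / d ≤ 1 - θ.1.ofLp ⬝ᵥ residual k x *ᵥ θ.1.ofLp} ≤
      ENNReal.ofReal (Real.exp (-(β * a)) * (√(1 - β) ^ k)⁻¹) := by
  have hd' : (0 : ℝ) < d := by exact_mod_cast hd
  set f : Sphere d → ENNReal := fun θ => ENNReal.ofReal
        (Real.exp (d * (β * (1 - θ.1.ofLp ⬝ᵥ residual k x *ᵥ θ.1.ofLp)) / 2)) with hf
  have hfm : Measurable f := by
    refine (ENNReal.continuous_ofReal.comp (Real.continuous_exp.comp ?_)).measurable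
    have : Continuous fun θ : Sphere d => θ.1.ofLp :=
      (PiLp.continuous_ofLp 2 _).comp continuous_subtype_val
    fun_prop
  have hsub : {θ : Sphere d | 2 * a / d ≤ 1 - θ.1.ofLp ⬝ᵥ residual k x *ᵥ θ.1.ofLp} ⊆
      {θ | ENNReal.ofReal (Real.exp (β * a)) ≤ f θ} := by
    intro θ hθ
    refine ENNReal.ofReal_le_ofReal (Real.exp_le_exp.2 ?_)
    rw [Set.mem_ofPred_eq, div_le_iff₀ hd'] at hθ
    nlinarith
  have hm := mul_meas_ge_le_lintegral₀ (μ := uniformSphere d) hfm.aemeasurable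
    (ENNReal.ofReal (Real.exp (β * a)))
  calc _ ≤ _ := measure_mono hsub
    _ = ENNReal.ofReal (Real.exp (-(β * a))) * (ENNReal.ofReal (Real.exp (β * a)) *
          uniformSphere d {θ | ENNReal.ofReal (Real.exp (β * a)) ≤ f θ}) := by
        rw [← mul_assoc, ← ENNReal.ofReal_mul (Real.exp_pos _).le, ← Real.exp_add]
        simp
    _ ≤ _ := by
        rw [ENNReal.ofReal_mul (Real.exp_pos _).le]
        gcongr
        exact hm.trans (lintegral_exp_uniformSphere_le hd h0 h1 k x)

end Sphere

/-! ### The GOE: measurability, entries and Fourier transform. -/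

section GOE

variable {d : ℕ}

/-- The variance of the GOE entry at position `p`. -/
def entryVar (p : UpperIndex d) : NNReal := if p.1.1 = p.1.2 then 2 else 1

theorem entryVar_ne_zero (p : UpperIndex d) : entryVar p ≠ 0 := by
  unfold entryVar; split_ifs <;> norm_num

theorem goe_eq_map :
    goe d = (Measure.pi fun p : UpperIndex d => gaussianReal 0 (entryVar p)).map
      symmetricOfUpper := rfl

/-- The weight is `1` on the diagonal and `2` above it. Hence the GOE variances turn entrywise
Gaussian exponents into full traces. -/
theorem sum_symmetric_eq_sum_upper (g : Fin d → Fin d → ℝ) (hg : ∀ i j, g i j = g j i) :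
    ∑ i, ∑ j, g i j = ∑ p : UpperIndex d, 2 / (entryVar p : ℝ) * g p.1.1 p.1.2 := by
  classical
  have h1 : ∀ p : UpperIndex d, 2 / (entryVar p : ℝ) * g p.1.1 p.1.2 =
      g p.1.1 p.1.2 + if p.1.1 = p.1.2 then 0 else g p.1.1 p.1.2 := fun p => by
    unfold entryVar; split_ifs <;> (simp; try ring)
  have h2 : ∀ f : Fin d × Fin d → ℝ, ∑ p : UpperIndex d, f p.1 =
      ∑ p : Fin d × Fin d, if p.1 ≤ p.2 then f p else 0 := fun f => by
    rw [← Finset.sum_filter, Finset.sum_subtype (p := fun p : Fin d × Fin d => p.1 ≤ p.2)]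
    simp
  have h3 : (∑ p : Fin d × Fin d, if p.1 < p.2 then g p.1 p.2 else 0) =
      ∑ p : Fin d × Fin d, if p.2 < p.1 then g p.1 p.2 else 0 := by
    rw [← (Equiv.prodComm (Fin d) (Fin d)).sum_comp]
    exact Finset.sum_congr rfl fun p _ => by simp [hg p.2 p.1]
  have h4 : (∑ p : Fin d × Fin d, if p.1 ≤ p.2 then (if p.1 = p.2 then 0 else g p.1 p.2) else 0) =
      ∑ p : Fin d × Fin d, if p.1 < p.2 then g p.1 p.2 else 0 :=
    Finset.sum_congr rfl fun p _ => by
      rcases lt_trichotomy p.1 p.2 with h | h | h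
      · simp [h, h.le, h.ne]
      · simp [h]
      · simp [h.not_ge, h.not_gt]
  rw [← Fintype.sum_prod_type', Finset.sum_congr rfl fun p _ => h1 p, Finset.sum_add_distrib,
    h2 fun p => g p.1 p.2, h2 fun p => if p.1 = p.2 then 0 else g p.1 p.2, h4, h3,
    ← Finset.sum_add_distrib]
  refine Finset.sum_congr rfl fun p _ => ?_
  rcases le_or_gt p.1 p.2 with h | h
  · simp [h, h.not_gt]
  · simp [h, h.not_ge]

theorem symmetricOfUpper_transpose (x : UpperIndex d → ℝ) :
    (symmetricOfUpper x)ᵀ = symmetricOfUpper x := by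
  ext i j
  simp [symmetricOfUpper, min_comm i j, max_comm i j]

theorem symmetricOfUpper_apply_upper (x : UpperIndex d → ℝ) (p : UpperIndex d) :
    symmetricOfUpper x p.1.1 p.1.2 = x p := by
  simp [symmetricOfUpper, p.2]

theorem measurable_matrix_iff {α : Type*} [MeasurableSpace α]
    {f : α → Matrix (Fin d) (Fin d) ℝ} : Measurable f ↔ ∀ i j, Measurable fun a => f a i j := by
  constructor
  · intro h i j
    have h1 : Measurable fun W : Fin d → Fin d → ℝ => W i j := by fun_prop
    exact h1.comp h
  · intro h
    exact measurable_pi_lambda (fun a => (f a : Fin d → Fin d → ℝ)) fun i =>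
      measurable_pi_lambda _ fun j => h i j

theorem measurable_matrix_apply (i j : Fin d) :
    Measurable fun W : Matrix (Fin d) (Fin d) ℝ => W i j :=
  measurable_matrix_iff.1 measurable_id i j

theorem measurable_symmetricOfUpper :
    Measurable (symmetricOfUpper : (UpperIndex d → ℝ) → Matrix (Fin d) (Fin d) ℝ) :=
  measurable_matrix_iff.2 fun _ _ => measurable_pi_apply _

instance : IsProbabilityMeasure (goe d) := by
  rw [goe_eq_map]
  exact Measure.isProbabilityMeasure_map measurable_symmetricOfUpper.aemeasurable

theorem measurable_matrix_mul {α : Type*} [MeasurableSpace α]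
    {f g : α → Matrix (Fin d) (Fin d) ℝ} (hf : Measurable f) (hg : Measurable g) :
    Measurable fun a => f a * g a := by
  rw [measurable_matrix_iff] at *
  intro i j
  simp only [mul_apply]
  exact Finset.measurable_sum _ fun k _ => (hf i k).mul (hg k j)

theorem measurable_matrix_add {α : Type*} [MeasurableSpace α]
    {f g : α → Matrix (Fin d) (Fin d) ℝ} (hf : Measurable f) (hg : Measurable g) :
    Measurable fun a => f a + g a :=
  measurable_matrix_iff.2 fun i j =>
    (measurable_matrix_iff.1 hf i j).add (measurable_matrix_iff.1 hg i j)

theorem measurable_matrix_sub {α : Type*} [MeasurableSpace α]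
    {f g : α → Matrix (Fin d) (Fin d) ℝ} (hf : Measurable f) (hg : Measurable g) :
    Measurable fun a => f a - g a :=
  measurable_matrix_iff.2 fun i j =>
    (measurable_matrix_iff.1 hf i j).sub (measurable_matrix_iff.1 hg i j)

theorem measurable_matrix_smul {α : Type*} [MeasurableSpace α] {c : α → ℝ}
    {f : α → Matrix (Fin d) (Fin d) ℝ} (hc : Measurable c) (hf : Measurable f) :
    Measurable fun a => c a • f a :=
  measurable_matrix_iff.2 fun i j => hc.mul (measurable_matrix_iff.1 hf i j)

theorem measurable_mulVec {α : Type*} [MeasurableSpace α]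
    {f : α → Matrix (Fin d) (Fin d) ℝ} {v : α → Fin d → ℝ} (hf : Measurable f)
    (hv : Measurable v) : Measurable fun a => f a *ᵥ v a := by
  rw [measurable_pi_iff] at *
  rw [measurable_matrix_iff] at hf
  intro i
  simp only [mulVec, dotProduct]
  exact Finset.measurable_sum _ fun k _ => (hf i k).mul (hv k)

theorem measurable_dotProduct {α : Type*} [MeasurableSpace α] {v w : α → Fin d → ℝ}
    (hv : Measurable v) (hw : Measurable w) : Measurable fun a => v a ⬝ᵥ w a := by
  rw [measurable_pi_iff] at *
  simp only [dotProduct]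
  exact Finset.measurable_sum _ fun k _ => (hv k).mul (hw k)

theorem measurable_vecMulVec {α : Type*} [MeasurableSpace α] {v w : α → Fin d → ℝ}
    (hv : Measurable v) (hw : Measurable w) : Measurable fun a => vecMulVec (v a) (w a) := by
  rw [measurable_pi_iff] at hv hw
  exact measurable_matrix_iff.2 fun i j => (hv i).mul (hw j)

theorem trace_transpose_mul_eq_sum (C W : Matrix (Fin d) (Fin d) ℝ) :
    (Cᵀ * W).trace = ∑ i, ∑ j, C i j * W i j := by
  simp only [trace, diag_apply, mul_apply, transpose_apply]
  rw [Finset.sum_comm]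

/-- Every linear functional on matrices is a trace pairing, and characteristic functions determine
finite measures. -/
theorem measure_ext_of_fourier {μ ν : Measure (Matrix (Fin d) (Fin d) ℝ)} [IsFiniteMeasure μ]
    [IsFiniteMeasure ν]
    (h : ∀ C : Matrix (Fin d) (Fin d) ℝ, ∫ W, Complex.exp ((Cᵀ * W).trace * Complex.I) ∂μ =
      ∫ W, Complex.exp ((Cᵀ * W).trace * Complex.I) ∂ν) : μ = ν := by
  let μ' : Measure (Fin d → Fin d → ℝ) := μ
  let ν' : Measure (Fin d → Fin d → ℝ) := ν
  have : IsFiniteMeasure μ' := ‹IsFiniteMeasure μ›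
  have : IsFiniteMeasure ν' := ‹IsFiniteMeasure ν›
  change μ' = ν'
  refine Measure.ext_of_charFunDual (funext fun L => ?_)
  rw [charFunDual_apply, charFunDual_apply]
  have hL : ∀ W : Fin d → Fin d → ℝ,
      L W = ((Matrix.of fun i j => L (Pi.single i (Pi.single j 1)))ᵀ * Matrix.of W).trace := by
    intro W
    rw [trace_transpose_mul_eq_sum]
    conv_lhs => rw [show W = ∑ i, ∑ j, W i j • Pi.single i (Pi.single j (1 : ℝ)) by
      ext i j
      simp only [Finset.sum_apply, Pi.smul_apply, Pi.single_apply,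
        apply_ite (fun f : Fin d → ℝ => f j),
        smul_eq_mul, Pi.zero_apply]
      simp]
    simp only [map_sum, map_smul, smul_eq_mul, Matrix.of_apply]
    exact Finset.sum_congr rfl fun i _ => Finset.sum_congr rfl fun j _ => mul_comm _ _
  have h1 := h (Matrix.of fun i j => L (Pi.single i (Pi.single j 1)))
  refine Eq.trans (integral_congr_ae (.of_forall fun W => ?_))
    (h1.trans (integral_congr_ae (.of_forall fun W => ?_)))
  · exact congrArg (fun t : ℝ => Complex.exp (t * Complex.I)) (hL W)
  · exact congrArg (fun t : ℝ => Complex.exp (t * Complex.I)) (hL W).symm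

/-- Symmetry of `W` lets only `C + Cᵀ` matter; the entries are independent, and their variances
assemble the exponent into a Frobenius norm. -/
theorem integral_cexp_goe (C : Matrix (Fin d) (Fin d) ℝ) :
    ∫ W, Complex.exp ((Cᵀ * W).trace * Complex.I) ∂goe d =
      Complex.exp (-((C + Cᵀ) * (C + Cᵀ)).trace / 4 : ℝ) := by
  set D := C + Cᵀ with hD
  have hDs : ∀ i j, D i j = D j i := fun i j => by simp [hD, add_comm]
  have hm : Measurable fun W : Matrix (Fin d) (Fin d) ℝ =>
      Complex.exp ((Cᵀ * W).trace * Complex.I) := by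
    have : Measurable fun W : Matrix (Fin d) (Fin d) ℝ => (Cᵀ * W).trace := by
      simp only [trace_transpose_mul_eq_sum]
      exact Finset.measurable_sum _ fun i _ => Finset.measurable_sum _ fun j _ =>
        (measurable_matrix_apply i j).const_mul _
    fun_prop
  have h1 : ∀ x : UpperIndex d → ℝ, (Cᵀ * symmetricOfUpper x).trace =
      ∑ p : UpperIndex d, D p.1.1 p.1.2 / entryVar p * x p := by
    intro x
    have hS : ∀ i j, symmetricOfUpper x i j = symmetricOfUpper x j i := fun i j => by
      conv_lhs => rw [← symmetricOfUpper_transpose, transpose_apply]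
    have h2 : (Cᵀ * symmetricOfUpper x).trace =
        (∑ i, ∑ j, D i j * symmetricOfUpper x i j) / 2 := by
      have e1 : ∑ i, ∑ j, C j i * symmetricOfUpper x i j =
          ∑ i, ∑ j, C i j * symmetricOfUpper x i j := by
        rw [Finset.sum_comm]
        exact Finset.sum_congr rfl fun i _ => Finset.sum_congr rfl fun j _ => by rw [hS]
      simp only [hD, Matrix.add_apply, add_mul, Finset.sum_add_distrib, transpose_apply]
      rw [trace_transpose_mul_eq_sum, e1, add_self_div_two]
    rw [h2, sum_symmetric_eq_sum_upper _ fun i j => by rw [hDs, hS], Finset.sum_div]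
    refine Finset.sum_congr rfl fun p _ => ?_
    rw [symmetricOfUpper_apply_upper]
    ring
  have h3 : (D * D).trace = ∑ p : UpperIndex d, 2 / (entryVar p : ℝ) * D p.1.1 p.1.2 ^ 2 := by
    rw [← sum_symmetric_eq_sum_upper (fun i j => D i j ^ 2) fun i j => by rw [hDs]]
    simp only [trace, diag_apply, mul_apply, pow_two]
    exact Finset.sum_congr rfl fun i _ => Finset.sum_congr rfl fun j _ => by rw [hDs j i]
  rw [goe_eq_map, integral_map measurable_symmetricOfUpper.aemeasurable hm.aestronglyMeasurable]
  simp only [h1]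
  have h4 : ∀ x : UpperIndex d → ℝ, Complex.exp
      ((∑ p : UpperIndex d, D p.1.1 p.1.2 / entryVar p * x p : ℝ) * Complex.I) =
      ∏ p : UpperIndex d, Complex.exp ((D p.1.1 p.1.2 / entryVar p : ℝ) * x p * Complex.I) := by
    intro x
    rw [← Complex.exp_sum, ← Finset.sum_mul]
    push_cast
    rfl
  simp only [h4]
  rw [integral_fintype_prod_eq_prod (𝕜 := ℂ) (fun (p : UpperIndex d) (y : ℝ) =>
    Complex.exp ((D p.1.1 p.1.2 / entryVar p : ℝ) * y * Complex.I))]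
  simp only [← charFun_apply_real, charFun_gaussianReal]
  rw [← Complex.exp_sum, h3]
  congr 1
  push_cast
  rw [← Finset.sum_neg_distrib, Finset.sum_div]
  refine Finset.sum_congr rfl fun p _ => ?_
  have : ((entryVar p : ℝ) : ℂ) ≠ 0 := by
    exact_mod_cast entryVar_ne_zero p
  field_simp
  ring

/-! ### Refreshing the block of a GOE matrix on the range of a projection. -/

/-- Replace the block of `W` on the range of `Q` by that of `W'`. -/
def resample (Q W W' : Matrix (Fin d) (Fin d) ℝ) : Matrix (Fin d) (Fin d) ℝ :=
  W - Q * W * Q + Q * W' * Q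

theorem measurable_resample {α : Type*} [MeasurableSpace α]
    {q f g : α → Matrix (Fin d) (Fin d) ℝ} (hq : Measurable q) (hf : Measurable f)
    (hg : Measurable g) : Measurable fun a => resample (q a) (f a) (g a) :=
  measurable_matrix_add
    (measurable_matrix_sub hf (measurable_matrix_mul (measurable_matrix_mul hq hf) hq))
    (measurable_matrix_mul (measurable_matrix_mul hq hg) hq)

/-- By Fourier transform this is Pythagoras: `D - QDQ` and `QDQ` are orthogonal for the trace form,
so the two Gaussian exponents add up to that of `D = C + Cᵀ`. -/
theorem map_resample_goe {Q : Matrix (Fin d) (Fin d) ℝ} (hQ : IsOrthProj Q) :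
    ((goe d).prod (goe d)).map (fun p => resample Q p.1 p.2) = goe d := by
  have hr : Measurable fun p : Matrix (Fin d) (Fin d) ℝ × Matrix (Fin d) (Fin d) ℝ =>
      resample Q p.1 p.2 := measurable_resample measurable_const measurable_fst measurable_snd
  have : IsProbabilityMeasure (((goe d).prod (goe d)).map (fun p => resample Q p.1 p.2)) :=
    Measure.isProbabilityMeasure_map hr.aemeasurable
  refine measure_ext_of_fourier fun C => ?_
  have hm : Measurable fun W : Matrix (Fin d) (Fin d) ℝ =>
      Complex.exp ((Cᵀ * W).trace * Complex.I) := by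
    have : Measurable fun W : Matrix (Fin d) (Fin d) ℝ => (Cᵀ * W).trace := by
      simp only [trace_transpose_mul_eq_sum]
      exact Finset.measurable_sum _ fun i _ => Finset.measurable_sum _ fun j _ =>
        (measurable_matrix_apply i j).const_mul _
    fun_prop
  rw [integral_map hr.aemeasurable hm.aestronglyMeasurable]
  have h1 : ∀ W : Matrix (Fin d) (Fin d) ℝ, (Cᵀ * (Q * W * Q)).trace = ((Q * C * Q)ᵀ * W).trace := by
    intro W
    rw [transpose_mul, transpose_mul, hQ.symm, ← Matrix.mul_assoc, trace_mul_comm]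
    simp only [Matrix.mul_assoc]
  have h2 : ∀ p : Matrix (Fin d) (Fin d) ℝ × Matrix (Fin d) (Fin d) ℝ,
      Complex.exp ((Cᵀ * resample Q p.1 p.2).trace * Complex.I) =
        Complex.exp (((C - Q * C * Q)ᵀ * p.1).trace * Complex.I) *
          Complex.exp (((Q * C * Q)ᵀ * p.2).trace * Complex.I) := by
    intro p
    rw [resample, mul_add, mul_sub, trace_add, trace_sub, h1, h1, ← Complex.exp_add, ← add_mul,
      transpose_sub, sub_mul, trace_sub]
    push_cast
    rfl
  simp only [h2]
  rw [integral_prod_mul (fun W : Matrix (Fin d) (Fin d) ℝ =>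
      Complex.exp (((C - Q * C * Q)ᵀ * W).trace * Complex.I))
    (fun W : Matrix (Fin d) (Fin d) ℝ => Complex.exp (((Q * C * Q)ᵀ * W).trace * Complex.I)),
    integral_cexp_goe,
    integral_cexp_goe, integral_cexp_goe, ← Complex.exp_add, ← Complex.ofReal_add]
  congr 3
  have h3 : Q * C * Q + (Q * C * Q)ᵀ = Q * (C + Cᵀ) * Q := by
    rw [transpose_mul, transpose_mul, hQ.symm]
    noncomm_ring
  have h4 : C - Q * C * Q + (C - Q * C * Q)ᵀ = (C + Cᵀ) - Q * (C + Cᵀ) * Q := by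
    rw [← h3, transpose_sub]
    abel
  rw [h3, h4]
  generalize C + Cᵀ = D
  have e1 : (Q * D * Q * D).trace = (Q * D * Q * (Q * D * Q)).trace := by
    calc (Q * D * Q * D).trace = (Q * Q * (D * Q * D)).trace := by
          rw [hQ.idem]; simp only [Matrix.mul_assoc]
      _ = (Q * (D * Q * D) * Q).trace := by
          rw [Matrix.mul_assoc, trace_mul_comm]
      _ = (Q * D * (Q * Q) * D * Q).trace := by rw [hQ.idem]; simp only [Matrix.mul_assoc]
      _ = _ := by simp only [Matrix.mul_assoc]
  have e2 : (D * (Q * D * Q)).trace = (Q * D * Q * D).trace := trace_mul_comm _ _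
  rw [sub_mul, mul_sub, mul_sub, trace_sub, trace_sub, trace_sub, e2, ← e1]
  ring

theorem lintegral_goe_eq_resample {Q : Matrix (Fin d) (Fin d) ℝ} (hQ : IsOrthProj Q)
    {F : Matrix (Fin d) (Fin d) ℝ → ENNReal} (hF : Measurable F) :
    ∫⁻ W, F W ∂goe d = ∫⁻ W, ∫⁻ W', F (resample Q W W') ∂goe d ∂goe d := by
  have hr : Measurable fun p : Matrix (Fin d) (Fin d) ℝ × Matrix (Fin d) (Fin d) ℝ =>
      resample Q p.1 p.2 := measurable_resample measurable_const measurable_fst measurable_snd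
  conv_lhs => rw [← map_resample_goe hQ]
  rw [lintegral_map hF hr]
  exact lintegral_prod _ (hF.comp hr).aemeasurable

/-! ### Shifting the GOE by a rank-one spike. -/

theorem gaussianReal_eq_withDensity (a : ℝ) {v : NNReal} (hv : v ≠ 0) :
    gaussianReal a v = (gaussianReal 0 v).withDensity
      fun x => ENNReal.ofReal (Real.exp (a / v * x - a ^ 2 / (2 * v))) := by
  have hv' : (v : ℝ) ≠ 0 := by exact_mod_cast hv
  rw [gaussianReal_of_var_ne_zero _ hv, gaussianReal_of_var_ne_zero _ hv, ← withDensity_mul _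
    (measurable_gaussianPDF _ _) (by fun_prop)]
  congr 1
  ext x
  rw [Pi.mul_apply, gaussianPDF, gaussianPDF, ← ENNReal.ofReal_mul (gaussianPDFReal_nonneg _ _ _),
    gaussianPDFReal, gaussianPDFReal, mul_assoc _ (Real.exp _), ← Real.exp_add]
  congr 3
  field_simp
  ring

theorem pi_withDensity_eq {ι : Type*} [Fintype ι] (μ : ι → Measure ℝ)
    [∀ i, IsProbabilityMeasure (μ i)] {f : ι → ℝ → ENNReal} (hf : ∀ i, Measurable (f i))
    [∀ i, SigmaFinite ((μ i).withDensity (f i))] :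
    Measure.pi (fun i => (μ i).withDensity (f i)) =
      (Measure.pi μ).withDensity fun x => ∏ i, f i (x i) := by
  refine Measure.pi_eq fun s hs => ?_
  rw [withDensity_apply _ (MeasurableSet.univ_pi hs),
    ← lintegral_indicator (MeasurableSet.univ_pi hs)]
  have h1 : (Set.univ.pi s).indicator (fun x : ι → ℝ => ∏ i, f i (x i)) =
      fun x => ∏ i, (s i).indicator (f i) (x i) := by
    classical
    ext x
    by_cases hx : x ∈ Set.univ.pi s
    · rw [Set.indicator_of_mem hx]
      exact Finset.prod_congr rfl fun i _ => by rw [Set.indicator_of_mem (hx i trivial)]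
    · rw [Set.indicator_of_notMem hx]
      simp only [Set.mem_pi, Set.mem_univ, true_imp_iff, not_forall] at hx
      obtain ⟨i, hi⟩ := hx
      exact (Finset.prod_eq_zero (Finset.mem_univ i) (Set.indicator_of_notMem hi _)).symm
  have hg : ∀ i, Measurable ((s i).indicator (f i)) := fun i => (hf i).indicator (hs i)
  rw [h1, lintegral_prod_eq_prod_lintegral_of_indepFun Finset.univ
    (fun i (x : ι → ℝ) => (s i).indicator (f i) (x i))
    (iIndepFun_pi (μ := μ) (X := fun i => (s i).indicator (f i)) fun i => (hg i).aemeasurable)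
    fun i => (hg i).comp (measurable_pi_apply i)]
  refine Finset.prod_congr rfl fun i _ => ?_
  rw [withDensity_apply _ (hs i), ← lintegral_indicator (hs i),
    (measurePreserving_eval μ i).lintegral_comp (hg i)]

/-- Cameron–Martin: each independent entry contributes its Gaussian shift density, and the product
collapses to a quadratic form in `θ`. -/
theorem lintegral_goe_add_vecMulVec (s : ℝ) (θ : Fin d → ℝ)
    {F : Matrix (Fin d) (Fin d) ℝ → ENNReal} (hF : Measurable F) :
    ∫⁻ W, F (W + s • vecMulVec θ θ) ∂goe d =
      ∫⁻ W, F W * ENNReal.ofReal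
        (Real.exp (s / 2 * (θ ⬝ᵥ W *ᵥ θ) - s ^ 2 / 4 * (θ ⬝ᵥ θ) ^ 2)) ∂goe d := by
  set a : UpperIndex d → ℝ := fun p => s * (θ p.1.1 * θ p.1.2) with ha
  have hadd : Measurable fun W : Matrix (Fin d) (Fin d) ℝ => W + s • vecMulVec θ θ :=
    measurable_matrix_add measurable_id measurable_const
  have hdens : Measurable fun W : Matrix (Fin d) (Fin d) ℝ => ENNReal.ofReal
        (Real.exp (s / 2 * (θ ⬝ᵥ W *ᵥ θ) - s ^ 2 / 4 * (θ ⬝ᵥ θ) ^ 2)) := by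
    have : Measurable fun W : Matrix (Fin d) (Fin d) ℝ => θ ⬝ᵥ W *ᵥ θ :=
      measurable_dotProduct measurable_const (measurable_mulVec measurable_id measurable_const)
    fun_prop
  have hshift : ∀ x : UpperIndex d → ℝ,
      symmetricOfUpper x + s • vecMulVec θ θ = symmetricOfUpper (fun p => x p + a p) := by
    intro x
    ext i j
    simp only [Matrix.add_apply, symmetricOfUpper, Matrix.smul_apply, vecMulVec_apply, of_apply, ha,
      smul_eq_mul]
    rcases le_total i j with h | h
    · simp [h]
    · simp [h, mul_comm (θ i)]
  have hpi : (Measure.pi fun p : UpperIndex d => gaussianReal 0 (entryVar p)).map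
      (fun x p => x p + a p) = (Measure.pi fun p : UpperIndex d => gaussianReal 0 (entryVar p)).withDensity
        fun x => ∏ p, ENNReal.ofReal
          (Real.exp (a p / entryVar p * x p - a p ^ 2 / (2 * entryVar p))) := by
    rw [Measure.pi_map_pi (f := fun p y => y + a p) fun p => by fun_prop]
    have : ∀ p : UpperIndex d, SigmaFinite ((gaussianReal 0 (entryVar p)).withDensity
        fun x => ENNReal.ofReal (Real.exp (a p / entryVar p * x - a p ^ 2 / (2 * entryVar p)))) := by
      intro p
      rw [← gaussianReal_eq_withDensity _ (entryVar_ne_zero p)]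
      infer_instance
    rw [← pi_withDensity_eq (fun p => gaussianReal 0 (entryVar p)) (f := fun p x =>
      ENNReal.ofReal (Real.exp (a p / entryVar p * x - a p ^ 2 / (2 * entryVar p))))
      fun p => by fun_prop]
    congr 1
    ext1 p
    rw [gaussianReal_map_add_const, zero_add, gaussianReal_eq_withDensity _ (entryVar_ne_zero p)]
  have hprod : ∀ x : UpperIndex d → ℝ, ∏ p, ENNReal.ofReal
      (Real.exp (a p / entryVar p * x p - a p ^ 2 / (2 * entryVar p))) = ENNReal.ofReal
        (Real.exp (s / 2 * (θ ⬝ᵥ symmetricOfUpper x *ᵥ θ) - s ^ 2 / 4 * (θ ⬝ᵥ θ) ^ 2)) := by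
    intro x
    rw [← ENNReal.ofReal_prod_of_nonneg fun p _ => (Real.exp_pos _).le, ← Real.exp_sum]
    congr 2
    have hS : ∀ i j, symmetricOfUpper x i j = symmetricOfUpper x j i := fun i j => by
      conv_lhs => rw [← symmetricOfUpper_transpose, transpose_apply]
    have e1 : θ ⬝ᵥ symmetricOfUpper x *ᵥ θ =
        ∑ i, ∑ j, θ i * θ j * symmetricOfUpper x i j := by
      simp only [dotProduct, mulVec, Finset.mul_sum]
      exact Finset.sum_congr rfl fun i _ => Finset.sum_congr rfl fun j _ => by ring
    have e2 : (θ ⬝ᵥ θ) ^ 2 = ∑ i, ∑ j, (θ i * θ j) ^ 2 := by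
      rw [dotProduct, pow_two, Finset.sum_mul_sum]
      exact Finset.sum_congr rfl fun i _ => Finset.sum_congr rfl fun j _ => by ring
    rw [e1, e2, sum_symmetric_eq_sum_upper _ fun i j => by rw [hS, mul_comm (θ i)],
      sum_symmetric_eq_sum_upper _ fun i j => by rw [mul_comm (θ i)], Finset.mul_sum,
      Finset.mul_sum, ← Finset.sum_sub_distrib]
    refine Finset.sum_congr rfl fun p _ => ?_
    have : (entryVar p : ℝ) ≠ 0 := by exact_mod_cast entryVar_ne_zero p
    rw [symmetricOfUpper_apply_upper, ha]
    field_simp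
    ring
  have e1 := lintegral_map (μ := Measure.pi fun p : UpperIndex d => gaussianReal 0 (entryVar p))
    (hF.comp hadd) measurable_symmetricOfUpper
  have e2 := lintegral_map (μ := Measure.pi fun p : UpperIndex d => gaussianReal 0 (entryVar p))
    (hF.mul hdens) measurable_symmetricOfUpper
  simp only [Function.comp_apply, Pi.mul_apply, hshift, ← hprod] at e1 e2
  rw [goe_eq_map, e1, e2]
  have hFS : Measurable fun x : UpperIndex d → ℝ => F (symmetricOfUpper x) :=
    hF.comp measurable_symmetricOfUpper
  rw [← lintegral_map (f := fun x => F (symmetricOfUpper x)) hFS (by fun_prop), hpi,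
    lintegral_withDensity_eq_lintegral_mul _ (by fun_prop) hFS]
  exact lintegral_congr fun x => mul_comm _ _

/-- The shift density has total mass one; this is the change of measure applied to a constant. -/
theorem lintegral_exp_goe (s : ℝ) (θ : Fin d → ℝ) :
    ∫⁻ W, ENNReal.ofReal (Real.exp (s / 2 * (θ ⬝ᵥ W *ᵥ θ))) ∂goe d =
      ENNReal.ofReal (Real.exp (s ^ 2 / 4 * (θ ⬝ᵥ θ) ^ 2)) := by
  have h := lintegral_goe_add_vecMulVec s θ (F := fun _ =>
    ENNReal.ofReal (Real.exp (s ^ 2 / 4 * (θ ⬝ᵥ θ) ^ 2))) measurable_const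
  simp only [← ENNReal.ofReal_mul (Real.exp_pos _).le, ← Real.exp_add, add_sub_cancel] at h
  rw [← h, lintegral_const, measure_univ, mul_one]

end GOE

/-! ### Runs of the algorithm and the fresh block left after `k` queries. -/

section Run

variable {d T : ℕ} {Ξ : Type*} [MeasurableSpace Ξ]

theorem measurable_deflate {α : Type*} [MeasurableSpace α] {q : α → Matrix (Fin d) (Fin d) ℝ}
    {v : α → Fin d → ℝ} (hq : Measurable q) (hv : Measurable v) :
    Measurable fun a => deflate (q a) (v a) := by
  have h := measurable_mulVec hq hv
  exact measurable_matrix_sub hq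
    (measurable_matrix_smul (measurable_dotProduct hv h).inv (measurable_vecMulVec h h))

theorem measurable_residual {α : Type*} [MeasurableSpace α] (k : ℕ)
    {x : α → Fin k → Fin d → ℝ} (hx : ∀ i, Measurable fun a => x a i) :
    Measurable fun a => residual k (x a) := by
  induction k with
  | zero => exact measurable_const
  | succ k ih =>
    exact measurable_deflate (ih fun i => hx i.castSucc) (hx (Fin.last k))

theorem resample_mulVec_of_mulVec_eq_zero {Q W W' : Matrix (Fin d) (Fin d) ℝ} {v : Fin d → ℝ}
    (hv : Q *ᵥ v = 0) : resample Q W W' *ᵥ v = W *ᵥ v := by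
  simp only [resample, add_mulVec, sub_mulVec, ← mulVec_mulVec, hv, mulVec_zero, sub_zero,
    add_zero]

theorem dotProduct_resample_mulVec {Q : Matrix (Fin d) (Fin d) ℝ} (hQ : IsOrthProj Q)
    (W W' : Matrix (Fin d) (Fin d) ℝ) (θ : Fin d → ℝ) :
    θ ⬝ᵥ resample Q W W' *ᵥ θ = θ ⬝ᵥ W *ᵥ θ - (Q *ᵥ θ) ⬝ᵥ W *ᵥ (Q *ᵥ θ) +
      (Q *ᵥ θ) ⬝ᵥ W' *ᵥ (Q *ᵥ θ) := by
  rw [resample, add_mulVec, sub_mulVec, ← mulVec_mulVec, ← mulVec_mulVec, ← mulVec_mulVec,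
    ← mulVec_mulVec, dotProduct_add, dotProduct_sub, hQ.dotProduct_mulVec_comm,
    hQ.dotProduct_mulVec_comm]

/-- For nested ranges, refreshing the small block inside the replacement of the large one equals
refreshing it afterwards. -/
theorem resample_resample {Q Q' : Matrix (Fin d) (Fin d) ℝ} (h1 : Q * Q' = Q') (h2 : Q' * Q = Q')
    (W W' W'' : Matrix (Fin d) (Fin d) ℝ) :
    resample Q W (resample Q' W' W'') = resample Q' (resample Q W W') W'' := by
  have e : ∀ X, Q * (Q' * X * Q') * Q = Q' * X * Q' := fun X => by
    rw [← Matrix.mul_assoc, ← Matrix.mul_assoc, h1, Matrix.mul_assoc, h2]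
  have e' : ∀ X, Q' * (Q * X * Q) * Q' = Q' * X * Q' := fun X => by
    rw [← Matrix.mul_assoc, ← Matrix.mul_assoc, h2, Matrix.mul_assoc, h1]
  simp only [resample, mul_add, add_mul, mul_sub, sub_mul, e, e']
  abel

namespace QueryAlgorithm

variable (A : QueryAlgorithm d T Ξ)

/-- The first `k` queries of a run. -/
def queries (M : Matrix (Fin d) (Fin d) ℝ) (ξ : Ξ) (k : ℕ) (hk : k ≤ T) : Fin k → Fin d → ℝ :=
  fun i => (A.history M ξ k hk i).1.ofLp

/-- The projection onto the complement of the first `k` queries. -/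
def blind (M : Matrix (Fin d) (Fin d) ℝ) (ξ : Ξ) (k : ℕ) (hk : k ≤ T) :
    Matrix (Fin d) (Fin d) ℝ :=
  residual k (A.queries M ξ k hk)

/-- The projection onto the complement of the vectors of the rounds up to and including `k`. -/
def blindNext (M : Matrix (Fin d) (Fin d) ℝ) (ξ : Ξ) (k : Fin (T + 1)) :
    Matrix (Fin d) (Fin d) ℝ :=
  deflate (A.blind M ξ k (Nat.le_of_lt_succ k.2)) (A.vec M ξ k).ofLp

theorem queries_castSucc (M : Matrix (Fin d) (Fin d) ℝ) (ξ : Ξ) (k : ℕ) (hk : k + 1 ≤ T)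
    (i : Fin k) :
    A.queries M ξ (k + 1) hk i.castSucc = A.queries M ξ k (Nat.le_of_succ_le hk) i := by
  simp [queries, history]

theorem queries_last (M : Matrix (Fin d) (Fin d) ℝ) (ξ : Ξ) (k : ℕ) (hk : k + 1 ≤ T) :
    A.queries M ξ (k + 1) hk (Fin.last k) =
      (A.vec M ξ ⟨k, Nat.lt_succ_of_lt hk⟩).ofLp := by
  simp [queries, history, vec]

theorem blind_succ (M : Matrix (Fin d) (Fin d) ℝ) (ξ : Ξ) (k : ℕ) (hk : k + 1 ≤ T) :
    A.blind M ξ (k + 1) hk = A.blindNext M ξ ⟨k, Nat.lt_succ_of_lt hk⟩ := by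
  simp only [blind, residual, blindNext, queries_castSucc, queries_last]

theorem isOrthProj_blind (M : Matrix (Fin d) (Fin d) ℝ) (ξ : Ξ) (k : ℕ) (hk : k ≤ T) :
    IsOrthProj (A.blind M ξ k hk) :=
  isOrthProj_residual _ _

/-- A run sees the matrix only through its action on the run's own queries, so changing the matrix
elsewhere leaves the history intact. -/
theorem history_congr {M M' : Matrix (Fin d) (Fin d) ℝ} {ξ : Ξ} (k : ℕ) (hk : k ≤ T)
    (h : ∀ i, M' *ᵥ A.queries M ξ k hk i = M *ᵥ A.queries M ξ k hk i) :
    A.history M' ξ k hk = A.history M ξ k hk := by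
  induction k with
  | zero => exact funext fun i => i.elim0
  | succ k ih =>
    have h1 := ih (Nat.le_of_succ_le hk) fun i => by
      rw [← A.queries_castSucc M ξ k hk i]; exact h _
    have h2 := h (Fin.last k)
    rw [queries_last] at h2
    simp only [history, h1]
    exact congrArg (fun w => Fin.snoc (α := fun _ => EuclideanSpace ℝ (Fin d) × EuclideanSpace ℝ (Fin d)) _
      (_, WithLp.toLp 2 w)) h2

theorem history_resample (W W' : Matrix (Fin d) (Fin d) ℝ) (ξ : Ξ) (c : ℝ) (k : ℕ) (hk : k ≤ T) :
    A.history (c • resample (A.blind (c • W) ξ k hk) W W') ξ k hk = A.history (c • W) ξ k hk := by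
  refine A.history_congr k hk fun i => ?_
  have h : A.blind (c • W) ξ k hk *ᵥ A.queries (c • W) ξ k hk i = 0 := residual_mulVec _ _ _
  rw [smul_mulVec, smul_mulVec, resample_mulVec_of_mulVec_eq_zero h]

theorem measurable_history (k : ℕ) (hk : k ≤ T) :
    Measurable fun p : Matrix (Fin d) (Fin d) ℝ × Ξ => A.history p.1 p.2 k hk := by
  induction k with
  | zero => exact measurable_pi_lambda _ fun i => i.elim0
  | succ k ih =>
    have h1 := ih (Nat.le_of_succ_le hk)
    have hv : Measurable fun p : Matrix (Fin d) (Fin d) ℝ × Ξ =>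
        ((A.next ⟨k, Nat.lt_succ_of_lt hk⟩ p.2 (A.history p.1 p.2 k (Nat.le_of_succ_le hk))).1 :
          EuclideanSpace ℝ (Fin d)) :=
      measurable_subtype_coe.comp ((A.measurable_next _).comp (measurable_snd.prodMk h1))
    refine measurable_pi_lambda _ fun i => ?_
    refine Fin.lastCases ?_ (fun j => ?_) i
    · simp only [history, Fin.snoc_last]
      refine hv.prodMk ?_
      have hv' := (WithLp.measurable_ofLp 2 (Fin d → ℝ)).comp hv
      exact (WithLp.measurable_toLp 2 (Fin d → ℝ)).comp (measurable_mulVec measurable_fst hv')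
    · simp only [history, Fin.snoc_castSucc]
      exact (measurable_pi_apply j).comp h1

theorem measurable_vec (k : Fin (T + 1)) :
    Measurable fun p : Matrix (Fin d) (Fin d) ℝ × Ξ => A.vec p.1 p.2 k :=
  measurable_subtype_coe.comp
    ((A.measurable_next _).comp (measurable_snd.prodMk (A.measurable_history _ _)))

theorem measurable_blind (k : ℕ) (hk : k ≤ T) :
    Measurable fun p : Matrix (Fin d) (Fin d) ℝ × Ξ => A.blind p.1 p.2 k hk :=
  measurable_residual k fun i => (WithLp.measurable_ofLp 2 (Fin d → ℝ)).comp
    (measurable_fst.comp ((measurable_pi_apply i).comp (A.measurable_history k hk)))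

theorem measurable_blindNext (k : Fin (T + 1)) :
    Measurable fun p : Matrix (Fin d) (Fin d) ℝ × Ξ => A.blindNext p.1 p.2 k :=
  measurable_deflate (A.measurable_blind _ _)
    ((WithLp.measurable_ofLp 2 (Fin d → ℝ)).comp (A.measurable_vec k))

theorem blind_eq_of_history_eq {M M' : Matrix (Fin d) (Fin d) ℝ} {ξ : Ξ} {k : ℕ} {hk : k ≤ T}
    (h : A.history M' ξ k hk = A.history M ξ k hk) : A.blind M' ξ k hk = A.blind M ξ k hk := by
  exact congrArg (fun h => residual k fun i => (h i).1.ofLp) h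

theorem blindNext_eq_of_history_eq {M M' : Matrix (Fin d) (Fin d) ℝ} {ξ : Ξ} {k : Fin (T + 1)}
    (h : A.history M' ξ k (Nat.le_of_lt_succ k.2) = A.history M ξ k (Nat.le_of_lt_succ k.2)) :
    A.blindNext M' ξ k = A.blindNext M ξ k := by
  rw [blindNext, blindNext, A.blind_eq_of_history_eq h, vec, vec, h]

/-- The projection here depends on `W`, so the fixed-projection statement does not apply directly.
The induction works because the next projection is a function of the current history, which
refreshing does not change: once `W` is fixed, the smaller block can be refreshed inside the fresh
copy `W'`. -/
theorem lintegral_goe_eq_resample_blind (ξ : Ξ) (c : ℝ) (k : ℕ) (hk : k ≤ T)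
    {F : Matrix (Fin d) (Fin d) ℝ → ENNReal} (hF : Measurable F) :
    ∫⁻ W, F W ∂goe d =
      ∫⁻ W, ∫⁻ W', F (resample (A.blind (c • W) ξ k hk) W W') ∂goe d ∂goe d := by
  have hb : ∀ k hk, Measurable fun W : Matrix (Fin d) (Fin d) ℝ => A.blind (c • W) ξ k hk :=
    fun k hk => (A.measurable_blind k hk).comp
      ((measurable_matrix_smul measurable_const measurable_id).prodMk measurable_const)
  induction k generalizing F with
  | zero => simp [blind, residual, resample]
  | succ k ih =>
    have hk' := Nat.le_of_succ_le hk
    have hQ := fun W : Matrix (Fin d) (Fin d) ℝ => A.isOrthProj_blind (c • W) ξ k hk'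
    have hstep : ∀ W : Matrix (Fin d) (Fin d) ℝ, A.blind (c • W) ξ (k + 1) hk =
        deflate (A.blind (c • W) ξ k hk')
          (A.vec (c • W) ξ ⟨k, Nat.lt_succ_of_lt hk⟩).ofLp := fun W => A.blind_succ _ _ _ _
    have hG : Measurable fun W => ∫⁻ W'', F (resample (A.blind (c • W) ξ (k + 1) hk) W W'') ∂goe d :=
      Measurable.lintegral_prod_right' (f := fun p : Matrix (Fin d) (Fin d) ℝ × Matrix (Fin d) (Fin d) ℝ =>
        F (resample (A.blind (c • p.1) ξ (k + 1) hk) p.1 p.2))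
        (hF.comp (measurable_resample ((hb _ _).comp measurable_fst) measurable_fst measurable_snd))
    rw [ih hk' hF, ih hk' hG]
    refine lintegral_congr fun W => ?_
    have hFr : Measurable fun W' => F (resample (A.blind (c • W) ξ k hk') W W') :=
      hF.comp (measurable_resample measurable_const measurable_const measurable_id)
    rw [lintegral_goe_eq_resample (A.isOrthProj_blind (c • W) ξ (k + 1) hk) hFr]
    refine lintegral_congr fun W' => lintegral_congr fun W'' => ?_
    have h1 : A.blind (c • resample (A.blind (c • W) ξ k hk') W W') ξ (k + 1) hk =
        A.blind (c • W) ξ (k + 1) hk := by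
      rw [blind_succ, blind_succ]
      exact A.blindNext_eq_of_history_eq (A.history_resample W W' ξ c k hk')
    rw [h1, resample_resample]
    · rw [hstep]; exact (hQ W).mul_deflate _
    · rw [hstep]; exact (hQ W).deflate_mul _

/-! ### Likelihood ratio of the history. -/

/-- The likelihood ratio, after `k` queries, of the spike `s • θ θᵀ` against no spike. -/
def likelihood (ξ : Ξ) (c : ℝ) (k : ℕ) (hk : k ≤ T) (s : ℝ) (θ : Fin d → ℝ)
    (W : Matrix (Fin d) (Fin d) ℝ) : ℝ :=
  Real.exp (s / 2 * (θ ⬝ᵥ W *ᵥ θ - (A.blind (c • W) ξ k hk *ᵥ θ) ⬝ᵥ W *ᵥ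
      (A.blind (c • W) ξ k hk *ᵥ θ)) -
    s ^ 2 / 4 * ((θ ⬝ᵥ θ) ^ 2 - (θ ⬝ᵥ A.blind (c • W) ξ k hk *ᵥ θ) ^ 2))

/-- After the change of measure, the invisible block is refreshed. The history stays fixed, while
the part of the density on that block integrates to `exp(s²/4 (θᵀQθ)²)`. -/
theorem lintegral_history_add_spike (ξ : Ξ) (c : ℝ) (k : ℕ) (hk : k ≤ T) (s : ℝ) (θ : Fin d → ℝ)
    {Φ : (Fin k → EuclideanSpace ℝ (Fin d) × EuclideanSpace ℝ (Fin d)) → ENNReal}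
    (hΦ : Measurable Φ) :
    ∫⁻ W, Φ (A.history (c • (W + s • vecMulVec θ θ)) ξ k hk) ∂goe d =
      ∫⁻ W, Φ (A.history (c • W) ξ k hk) *
        ENNReal.ofReal (A.likelihood ξ c k hk s θ W) ∂goe d := by
  have hh : Measurable fun W : Matrix (Fin d) (Fin d) ℝ => Φ (A.history (c • W) ξ k hk) :=
    hΦ.comp ((A.measurable_history k hk).comp
      ((measurable_matrix_smul measurable_const measurable_id).prodMk measurable_const))
  have hd : Measurable fun W : Matrix (Fin d) (Fin d) ℝ => ENNReal.ofReal
      (Real.exp (s / 2 * (θ ⬝ᵥ W *ᵥ θ) - s ^ 2 / 4 * (θ ⬝ᵥ θ) ^ 2)) := by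
    have : Measurable fun W : Matrix (Fin d) (Fin d) ℝ => θ ⬝ᵥ W *ᵥ θ :=
      measurable_dotProduct measurable_const (measurable_mulVec measurable_id measurable_const)
    fun_prop
  have h0 := A.lintegral_goe_eq_resample_blind ξ c k hk (hh.mul hd)
  simp only [Pi.mul_apply] at h0
  rw [lintegral_goe_add_vecMulVec s θ hh, h0]
  refine lintegral_congr fun W => ?_
  simp only [history_resample]
  have hQ := A.isOrthProj_blind (c • W) ξ k hk
  rw [likelihood]
  set Q := A.blind (c • W) ξ k hk
  have h1 : ∀ W', Φ (A.history (c • W) ξ k hk) * ENNReal.ofReal (Real.exp (s / 2 *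
      (θ ⬝ᵥ resample Q W W' *ᵥ θ) - s ^ 2 / 4 * (θ ⬝ᵥ θ) ^ 2)) =
      Φ (A.history (c • W) ξ k hk) * ENNReal.ofReal (Real.exp (s / 2 *
        (θ ⬝ᵥ W *ᵥ θ - (Q *ᵥ θ) ⬝ᵥ W *ᵥ (Q *ᵥ θ)) - s ^ 2 / 4 * (θ ⬝ᵥ θ) ^ 2)) *
        ENNReal.ofReal (Real.exp (s / 2 * ((Q *ᵥ θ) ⬝ᵥ W' *ᵥ (Q *ᵥ θ)))) := fun W' => by
    rw [mul_assoc, ← ENNReal.ofReal_mul (Real.exp_pos _).le, ← Real.exp_add,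
      dotProduct_resample_mulVec hQ]
    congr 3
    ring
  simp only [h1]
  have hm : Measurable fun W' : Matrix (Fin d) (Fin d) ℝ =>
      ENNReal.ofReal (Real.exp (s / 2 * ((Q *ᵥ θ) ⬝ᵥ W' *ᵥ (Q *ᵥ θ)))) := by
    have : Measurable fun W' : Matrix (Fin d) (Fin d) ℝ => (Q *ᵥ θ) ⬝ᵥ W' *ᵥ (Q *ᵥ θ) :=
      measurable_dotProduct measurable_const (measurable_mulVec measurable_id measurable_const)
    fun_prop
  rw [lintegral_const_mul _ hm, lintegral_exp_goe, mul_assoc,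
    ← ENNReal.ofReal_mul (Real.exp_pos _).le, ← Real.exp_add, ← hQ.dotProduct_self]
  congr 3
  ring

theorem lintegral_likelihood (ξ : Ξ) (c : ℝ) (k : ℕ) (hk : k ≤ T) (s : ℝ) (θ : Fin d → ℝ) :
    ∫⁻ W, ENNReal.ofReal (A.likelihood ξ c k hk s θ W) ∂goe d = 1 := by
  have h := A.lintegral_history_add_spike ξ c k hk s θ (Φ := fun _ => 1) measurable_const
  simpa using h.symm

/-- The exponent is linear plus quadratic in `s`; replacing `s` by `p s` matches the linear part and
leaves a surplus in the quadratic one. -/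
theorem likelihood_rpow (ξ : Ξ) (c : ℝ) (k : ℕ) (hk : k ≤ T) (s p : ℝ) (θ : Fin d → ℝ)
    (W : Matrix (Fin d) (Fin d) ℝ) :
    A.likelihood ξ c k hk s θ W ^ p = A.likelihood ξ c k hk (p * s) θ W *
      Real.exp ((p ^ 2 - p) * s ^ 2 / 4 *
        ((θ ⬝ᵥ θ) ^ 2 - (θ ⬝ᵥ A.blind (c • W) ξ k hk *ᵥ θ) ^ 2)) := by
  rw [likelihood, likelihood, ← Real.exp_mul, ← Real.exp_add]
  congr 1
  ring

theorem measurable_likelihood (ξ : Ξ) (c : ℝ) (k : ℕ) (hk : k ≤ T) (s : ℝ) :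
    Measurable fun q : (Fin d → ℝ) × Matrix (Fin d) (Fin d) ℝ =>
      A.likelihood ξ c k hk s q.1 q.2 := by
  have hb : Measurable fun q : (Fin d → ℝ) × Matrix (Fin d) (Fin d) ℝ =>
      A.blind (c • q.2) ξ k hk := (A.measurable_blind k hk).comp
      ((measurable_matrix_smul measurable_const measurable_snd).prodMk measurable_const)
  have h1 : Measurable fun q : (Fin d → ℝ) × Matrix (Fin d) (Fin d) ℝ => q.1 ⬝ᵥ q.2 *ᵥ q.1 :=
    measurable_dotProduct measurable_fst (measurable_mulVec measurable_snd measurable_fst)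
  have hy := measurable_mulVec hb measurable_fst
  have h2 := measurable_dotProduct hy (measurable_mulVec measurable_snd hy)
  have h3 : Measurable fun q : (Fin d → ℝ) × Matrix (Fin d) (Fin d) ℝ => q.1 ⬝ᵥ q.1 :=
    measurable_dotProduct measurable_fst measurable_fst
  have h4 := measurable_dotProduct (v := fun q : (Fin d → ℝ) × Matrix (Fin d) (Fin d) ℝ => q.1)
    measurable_fst hy
  unfold likelihood
  exact (((h1.sub h2).const_mul _).sub (((h3.pow_const 2).sub (h4.pow_const 2)).const_mul _)).exp

end QueryAlgorithm

end Run

/-! ### Choice of constants and expansion of `c(δ,λ)`. -/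

section Numerics

theorem growthConst_mul_bounds {lam δ : ℝ} (hl : 0 < lam) (hl2 : 1 < 2 * lam ^ 2) (h0 : 0 < δ)
    (h1 : δ < 1) :
    2 * lam ^ 2 * growthConst δ lam * (1 - √(1 / (1 + Real.log (1 / δ)))) =
      (1 + lam ^ 2) * (2 / (1 - 1 / (2 * lam ^ 2))) ∧
    0 < √(1 / (1 + Real.log (1 / δ))) ∧ √(1 / (1 + Real.log (1 / δ))) < 1 ∧
    4 ≤ 2 * lam ^ 2 * growthConst δ lam := by
  have hL : 0 < Real.log (1 / δ) := Real.log_pos (by rw [lt_div_iff₀ h0]; linarith)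
  have hs0 : 0 < √(1 / (1 + Real.log (1 / δ))) := Real.sqrt_pos.2 (by positivity)
  have hs1 : √(1 / (1 + Real.log (1 / δ))) < 1 := by
    rw [Real.sqrt_lt' one_pos, div_lt_iff₀ (by positivity)]
    linarith
  rw [growthConst]
  set σ := √(1 / (1 + Real.log (1 / δ))) with hσ
  have hA : 0 < 1 - 1 / (2 * lam ^ 2) := by
    rw [sub_pos, div_lt_one (by positivity)]
    exact hl2
  have hq : 2 * lam ^ 2 * ((1 + 1 / lam ^ 2) * ((1 - 1 / (2 * lam ^ 2)) * (1 - σ))⁻¹) =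
      (2 * lam ^ 2 + 2) / (1 - 1 / (2 * lam ^ 2)) / (1 - σ) := by
    rw [mul_inv, div_eq_mul_inv, div_eq_mul_inv]
    have : lam ^ 2 ≠ 0 := by positivity
    generalize (1 - 1 / (2 * lam ^ 2))⁻¹ = u
    field_simp
  rw [hq]
  have h1σ : 0 < 1 - σ := by linarith
  refine ⟨?_, hs0, hs1, ?_⟩
  · rw [div_mul_cancel₀ _ h1σ.ne']
    ring
  · have h2 : 4 ≤ (2 * lam ^ 2 + 2) / (1 - 1 / (2 * lam ^ 2)) := by
      rw [le_div_iff₀ hA]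
      have e : 1 / (2 * lam ^ 2) * (2 * lam ^ 2) = 1 := by field_simp
      have : 0 < 1 / (2 * lam ^ 2) := by positivity
      nlinarith [sq_nonneg (2 * lam ^ 2 - 1)]
    rw [le_div_iff₀ h1σ]
    nlinarith

theorem natCast_succ_le_four_pow (k : ℕ) : ((k : ℝ) + 1) ≤ 4 ^ k := by
  induction k with
  | zero => norm_num
  | succ k ih => rw [pow_succ]; push_cast; nlinarith [(Nat.cast_nonneg k : (0 : ℝ) ≤ k)]

/-- Round `0`: the tail for one vector, with no change of measure. The cross term `2y` in `(y + 1)²`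
absorbs the prefactor. -/
theorem first_tail_le {δ : ℝ} (h0 : 0 < δ) (h1 : δ < 1) :
    ∃ β : ℝ, 0 ≤ β ∧ β < 1 ∧
      Real.exp (-(β * (√(Real.log (1 / δ)) + 1) ^ 2)) * (√(1 - β) ^ 1)⁻¹ ≤ δ := by
  have hL : 0 < Real.log (1 / δ) := Real.log_pos (by rw [lt_div_iff₀ h0]; linarith)
  set y := √(Real.log (1 / δ)) with hy
  have hy0 : 0 ≤ y := Real.sqrt_nonneg _
  have hyL : y ^ 2 = Real.log (1 / δ) := Real.sq_sqrt hL.le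
  have hδ : δ = Real.exp (-y ^ 2) := by
    rw [hyL, one_div, Real.log_inv, neg_neg, Real.exp_log h0]
  set a := (y + 1) ^ 2 with ha
  have ha1 : 1 ≤ a := by nlinarith
  -- This `β` minimizes `exp(-βa)(1 - β)^{-1/2}`.
  refine ⟨1 - 1 / (2 * a), ?_, ?_, ?_⟩
  · rw [sub_nonneg, div_le_one (by positivity)]; linarith
  · have : 0 < 1 / (2 * a) := by positivity
    linarith
  · have e1 : -((1 - 1 / (2 * a)) * a) = -y ^ 2 + (-(2 * y) + -(1 / 2)) := by
      have : (1 - 1 / (2 * a)) * a = a - 1 / 2 := by field_simp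
      rw [this, ha]; ring
    have e2 : (√(1 - (1 - 1 / (2 * a))) ^ 1)⁻¹ = √2 * (y + 1) := by
      rw [pow_one, sub_sub_cancel, one_div, Real.sqrt_inv, inv_inv, Real.sqrt_mul zero_le_two, ha,
        Real.sqrt_sq (by linarith)]
    rw [e1, e2, Real.exp_add, ← hδ, mul_assoc]
    refine mul_le_of_le_one_right h0.le ?_
    have h3 : √2 ≤ Real.exp (1 / 2) := by
      rw [Real.sqrt_le_left (Real.exp_pos _).le, ← Real.exp_nat_mul]
      have := Real.add_one_le_exp (1 : ℝ)
      norm_num at *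
      linarith
    have h4 : y + 1 ≤ Real.exp (2 * y) := by
      have := Real.add_one_le_exp (2 * y)
      linarith
    calc _ ≤ Real.exp (-(2 * y) + -(1 / 2)) * (Real.exp (1 / 2) * Real.exp (2 * y)) := by gcongr
      _ = 1 := by rw [← Real.exp_add, ← Real.exp_add, ← Real.exp_zero]; congr 1; ring

/-- The Hölder cost times the power `1/(1 + λ²)` of the tail for `k + 2` vectors, i.e. the jump
bound at round `k + 1`. -/
theorem later_tail_le {lam δ : ℝ} (hl : 0 < lam) (hl2 : 1 < 2 * lam ^ 2) (h0 : 0 < δ)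
    (h1 : δ < 1) (k : ℕ) :
    ∃ β : ℝ, 0 ≤ β ∧ β < 1 ∧
      Real.exp ((2 * lam ^ 2 * growthConst δ lam) ^ k * (√(Real.log (1 / δ)) + 1) ^ 2) *
        (Real.exp (-(β * ((2 * lam ^ 2 * growthConst δ lam) ^ (k + 1) *
          (√(Real.log (1 / δ)) + 1) ^ 2))) * (√(1 - β) ^ (k + 2))⁻¹) ^ (1 / (1 + lam ^ 2)) ≤
      δ ^ (k + 1) := by
  obtain ⟨hq, hs0, hs1, hq4⟩ := growthConst_mul_bounds hl hl2 h0 h1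
  have hL : 0 < Real.log (1 / δ) := Real.log_pos (by rw [lt_div_iff₀ h0]; linarith)
  have hσ2 : √(1 / (1 + Real.log (1 / δ))) ^ 2 = 1 / (1 + Real.log (1 / δ)) :=
    Real.sq_sqrt (by positivity)
  set σ := √(1 / (1 + Real.log (1 / δ))) with hσ
  set q := 2 * lam ^ 2 * growthConst δ lam with hqd
  have hδ : δ = Real.exp (-Real.log (1 / δ)) := by
    rw [one_div, Real.log_inv, neg_neg, Real.exp_log h0]
  set ℓ := Real.log (1 / δ) with hℓ
  have hy0 : 0 ≤ √ℓ := Real.sqrt_nonneg _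
  have hy2 : √ℓ ^ 2 = ℓ := Real.sq_sqrt hL.le
  set b := (√ℓ + 1) ^ 2 with hb
  have hb1 : 1 + ℓ ≤ b := by nlinarith
  have hbσ : 1 ≤ b * σ ^ 2 := by
    rw [hσ2, mul_one_div, le_div_iff₀ (by positivity)]
    linarith
  have hqk : 4 ^ k ≤ q ^ k := pow_le_pow_left₀ (by norm_num) hq4 k
  have hk1 := natCast_succ_le_four_pow k
  have hqpos : 0 < q := by linarith
  -- Half of the loss `σ` sits in `β`; the other half pays for `(1 - β)^{-(k+2)/2}`, using `bσ² ≥ 1`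
  -- and `q^(k+1) ≥ 2(k+2)`. The rate `1 - σ` that remains is the factor built into `c(δ,λ)`.
  refine ⟨1 - σ / 2, by linarith, by linarith, ?_⟩
  have hroot : (√(1 - (1 - σ / 2)) ^ (k + 2))⁻¹ ≤ Real.exp ((k + 2) / σ) := by
    have h5 : (√(1 - (1 - σ / 2)))⁻¹ ≤ Real.exp (1 / σ) := by
      rw [sub_sub_cancel, ← Real.sqrt_inv, Real.sqrt_le_left (Real.exp_pos _).le,
        ← Real.exp_nat_mul]
      have := Real.add_one_le_exp (2 * (1 / σ))
      push_cast
      rw [inv_div]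
      calc 2 / σ = 2 * (1 / σ) := by ring
        _ ≤ _ := by linarith
    calc _ = (√(1 - (1 - σ / 2)))⁻¹ ^ (k + 2) := by rw [inv_pow]
      _ ≤ Real.exp (1 / σ) ^ (k + 2) := by gcongr
      _ = _ := by rw [← Real.exp_nat_mul]; congr 1; push_cast; ring
  have hbase : Real.exp (-((1 - σ / 2) * (q ^ (k + 1) * b))) *
      (√(1 - (1 - σ / 2)) ^ (k + 2))⁻¹ ≤ Real.exp (-((1 - σ) * (q ^ (k + 1) * b))) := by
    calc _ ≤ Real.exp (-((1 - σ / 2) * (q ^ (k + 1) * b))) * Real.exp ((k + 2) / σ) := by gcongr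
      _ ≤ _ := by
        rw [← Real.exp_add, Real.exp_le_exp]
        suffices (k + 2) / σ ≤ σ / 2 * (q ^ (k + 1) * b) by linarith
        rw [div_le_iff₀ hs0]
        have h6 : 2 * ((k : ℝ) + 2) ≤ q ^ (k + 1) := by
          rw [pow_succ]
          have : (4 : ℝ) ^ k * 4 ≤ q ^ k * q := by gcongr
          nlinarith [(Nat.cast_nonneg k : (0 : ℝ) ≤ k)]
        have h7 : q ^ (k + 1) * 1 ≤ q ^ (k + 1) * (b * σ ^ 2) := by gcongr
        calc (k : ℝ) + 2 ≤ q ^ (k + 1) * (b * σ ^ 2) / 2 := by linarith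
          _ = _ := by ring
  have hpos : 0 ≤ Real.exp (-((1 - σ / 2) * (q ^ (k + 1) * b))) *
      (√(1 - (1 - σ / 2)) ^ (k + 2))⁻¹ := by positivity
  calc _ ≤ Real.exp (q ^ k * b) *
        Real.exp (-((1 - σ) * (q ^ (k + 1) * b))) ^ (1 / (1 + lam ^ 2)) := by
        gcongr
    _ = Real.exp (q ^ k * b - (2 / (1 - 1 / (2 * lam ^ 2))) * (q ^ k * b)) := by
        rw [← Real.exp_mul, ← Real.exp_add]
        congr 1
        have : (1 - σ) * (q ^ (k + 1) * b) =
            (1 + lam ^ 2) * ((2 / (1 - 1 / (2 * lam ^ 2))) * (q ^ k * b)) := by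
          rw [pow_succ]
          linear_combination (q ^ k * b) * hq
        rw [this]
        have h8 : 1 + lam ^ 2 ≠ 0 := by positivity
        field_simp
        ring
    _ ≤ Real.exp (-((k + 1 : ℕ) * ℓ)) := by
        rw [Real.exp_le_exp]
        -- With this factor at least `2`, the tail beats the Hölder cost by `exp(-q^k b)`, and `q^k
        -- b ≥ (k + 1)ℓ`.
        have h9 : 2 ≤ 2 / (1 - 1 / (2 * lam ^ 2)) := by
          have h10 : 0 < 1 - 1 / (2 * lam ^ 2) := by
            rw [sub_pos, div_lt_one (by positivity)]
            exact hl2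
          rw [le_div_iff₀ h10]
          have : 0 < 1 / (2 * lam ^ 2) := by positivity
          linarith
        have h11 : 0 ≤ q ^ k * b := by positivity
        have h12 : ((k : ℝ) + 1) * ℓ ≤ q ^ k * b := by
          have : ℓ ≤ b := by linarith
          gcongr
          linarith
        push_cast
        nlinarith
    _ = δ ^ (k + 1) := by
        conv_rhs => rw [hδ]
        rw [← Real.exp_nat_mul]
        congr 1
        ring

theorem sum_first_add_geometric_le {δ : ℝ} (h0 : 0 < δ) (h1 : δ < 1) (T : ℕ) :
    δ + ∑ i : Fin T, δ ^ ((i : ℕ) + 1) ≤ 2 * δ / (1 - δ) := by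
  have h2 : 0 < 1 - δ := by linarith
  have h3 : ∑ i : Fin T, δ ^ ((i : ℕ) + 1) ≤ δ / (1 - δ) := by
    rw [Fin.sum_univ_eq_sum_range fun i => δ ^ (i + 1)]
    simp only [pow_succ]
    rw [← Finset.sum_mul, le_div_iff₀ h2]
    have h4 := geom_sum_mul_neg δ T
    have h5 : 0 ≤ δ ^ T := by positivity
    calc _ = (∑ i ∈ Finset.range T, δ ^ i) * (1 - δ) * δ := by ring
      _ ≤ δ := by rw [h4]; nlinarith
  have h6 : δ ≤ δ / (1 - δ) := by
    rw [le_div_iff₀ h2]; nlinarith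
  calc _ ≤ δ / (1 - δ) + δ / (1 - δ) := by linarith
    _ = _ := by ring

theorem growthConst_expansion : ∃ r : ℝ → ℝ, Tendsto r (𝓝[>] 0) (𝓝 0) ∧
    (fun p : ℝ × ℝ => growthConst p.1 p.2 - 1 - r p.1)
      =o[(𝓝[>] 0) ×ˢ atTop] (fun p : ℝ × ℝ => 1 / p.2) := by
  have hlog : Tendsto (fun δ : ℝ => 1 + Real.log (1 / δ)) (𝓝[>] 0) atTop := by
    refine tendsto_atTop_add_const_left _ _ (Real.tendsto_log_atTop.comp ?_)
    exact (tendsto_inv_nhdsGT_zero (𝕜 := ℝ)).congr fun x => (one_div x).symm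
  have hσ : Tendsto (fun δ : ℝ => 1 - √(1 / (1 + Real.log (1 / δ)))) (𝓝[>] 0) (𝓝 1) := by
    have h1 : Tendsto (fun δ : ℝ => 1 / (1 + Real.log (1 / δ))) (𝓝[>] 0) (𝓝 0) := by
      simpa only [one_div, Function.comp_def] using (tendsto_inv_atTop_zero (𝕜 := ℝ)).comp hlog
    have h2 := h1.sqrt
    rw [Real.sqrt_zero] at h2
    simpa using h2.const_sub 1
  have hinv : Tendsto (fun δ : ℝ => (1 - √(1 / (1 + Real.log (1 / δ))))⁻¹) (𝓝[>] 0) (𝓝 1) := by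
    simpa using hσ.inv₀ one_ne_zero
  -- `r` is the limit of `c(δ,λ) - 1` as `λ → ∞`; the remaining error is of order `1/λ²`.
  refine ⟨fun δ => (1 - √(1 / (1 + Real.log (1 / δ))))⁻¹ - 1, by simpa using hinv.sub_const 1, ?_⟩
  have hu : Tendsto (fun p : ℝ × ℝ => 1 / p.2) ((𝓝[>] 0) ×ˢ atTop) (𝓝 0) := by
    have := (tendsto_inv_atTop_zero (𝕜 := ℝ)).comp
      (tendsto_snd (f := 𝓝[>] (0 : ℝ)) (g := (atTop : Filter ℝ)))
    simpa only [one_div, Function.comp_def] using this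
  have hf : Tendsto (fun p : ℝ × ℝ => (1 - √(1 / (1 + Real.log (1 / p.1))))⁻¹ *
      (3 / 2 * (1 / p.2) / (1 - (1 / p.2) ^ 2 / 2))) ((𝓝[>] 0) ×ˢ atTop) (𝓝 0) := by
    have h1 := ((hu.const_mul (3 / 2)).div (((hu.pow 2).div_const 2).const_sub 1) (by norm_num))
    have h2 := (hinv.comp (tendsto_fst (f := 𝓝[>] (0 : ℝ)) (g := (atTop : Filter ℝ)))).mul h1
    simpa using h2
  have h3 := isLittleO_iff_tendsto' (f := fun p : ℝ × ℝ =>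
    growthConst p.1 p.2 - 1 - ((1 - √(1 / (1 + Real.log (1 / p.1))))⁻¹ - 1))
    (g := fun p : ℝ × ℝ => 1 / p.2) (l := (𝓝[>] 0) ×ˢ atTop) ?_
  · refine h3.2 (hf.congr' ?_)
    filter_upwards [(eventually_gt_atTop (1 : ℝ)).prod_inr (𝓝[>] (0 : ℝ))] with p hp
    have hp0 : p.2 ≠ 0 := by linarith
    have hA : 1 - (1 / p.2) ^ 2 / 2 ≠ 0 := by
      have : (1 / p.2) ^ 2 ≤ 1 := by
        rw [div_pow, one_pow, div_le_one (by positivity)]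
        nlinarith
      linarith
    have hA' : 1 - 1 / (2 * p.2 ^ 2) = 1 - (1 / p.2) ^ 2 / 2 := by field_simp
    rw [growthConst, hA', mul_inv]
    generalize (1 - √(1 / (1 + Real.log (1 / p.1))))⁻¹ = w
    have e : 1 / p.2 ^ 2 = (1 / p.2) ^ 2 := by rw [div_pow, one_pow]
    have hu0 : 1 / p.2 ≠ 0 := one_div_ne_zero hp0
    rw [e]
    generalize 1 / p.2 = u at *
    have hA2 : 2 - u ^ 2 ≠ 0 := fun h => hA (by linarith)
    have e2 : 1 - u ^ 2 / 2 = (2 - u ^ 2) / 2 := by ring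
    rw [eq_div_iff hu0, e2]
    field_simp
    ring
  · filter_upwards [(eventually_gt_atTop (1 : ℝ)).prod_inr (𝓝[>] (0 : ℝ))] with p hp h
    exact absurd h (one_div_ne_zero (by linarith))

end Numerics

/-! ### Truncated change of measure, jumps of the potential and summation. -/

section Main

variable {d T : ℕ} {Ξ : Type*} [MeasurableSpace Ξ]

theorem Sphere.measurable_ofLp : Measurable fun θ : Sphere d => θ.1.ofLp :=
  (WithLp.measurable_ofLp 2 (Fin d → ℝ)).comp measurable_subtype_coe

/-- Hölder with the indicator kept inside the `p`-norm, so that `L^p` has to be controlled on `S`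
only; globally its moment could be far too large. -/
theorem lintegral_indicator_mul_le {α : Type*} [MeasurableSpace α] (μ : Measure α) {p : ℝ}
    (hp : 1 < p) {S : Set α} (hS : MeasurableSet S) {L L' : α → ENNReal} (hL : Measurable L)
    (hL' : Measurable L') (C : ENNReal) (h : ∀ q ∈ S, L q ^ p ≤ C * L' q)
    (hint : ∫⁻ q, L' q ∂μ ≤ 1) :
    ∫⁻ q, S.indicator (fun _ => (1 : ENNReal)) q * L q ∂μ ≤
      C ^ (1 / p) * (∫⁻ q, S.indicator (fun _ => (1 : ENNReal)) q ∂μ) ^ (1 - 1 / p) := by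
  have hp0 : 0 < p := by linarith
  have hpq : p.HolderConjugate (1 - 1 / p)⁻¹ := by
    have h := Real.HolderConjugate.conjExponent hp
    rwa [show Real.conjExponent p = (1 - 1 / p)⁻¹ by
      rw [Real.conjExponent]; field_simp] at h
  have hLS : ∀ q, S.indicator (fun _ => (1 : ENNReal)) q * L q = S.indicator L q := fun q => by
    by_cases hq : q ∈ S <;> simp [hq]
  have hind : Measurable (S.indicator fun _ => (1 : ENNReal)) := measurable_const.indicator hS
  have hH := ENNReal.lintegral_mul_le_Lp_mul_Lq μ hpq (hL.indicator hS).aemeasurable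
    hind.aemeasurable
  have e1 : ∀ q, (S.indicator L * S.indicator fun _ => (1 : ENNReal)) q = S.indicator L q :=
    fun q => by by_cases hq : q ∈ S <;> simp [hq]
  have e2 : ∀ q, S.indicator (fun _ => (1 : ENNReal)) q ^ (1 - 1 / p)⁻¹ =
      S.indicator (fun _ => (1 : ENNReal)) q := fun q => by
    by_cases hq : q ∈ S
    · simp [hq]
    · simp only [Set.indicator_of_notMem hq, ENNReal.zero_rpow_of_pos hpq.symm.pos]
  have e3 : ∀ q, S.indicator L q ^ p ≤ C * L' q := fun q => by
    by_cases hq : q ∈ S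
    · simpa [hq] using h q hq
    · simp [Set.indicator_of_notMem hq, ENNReal.zero_rpow_of_pos hp0]
  simp only [e1, e2, one_div (1 - 1 / p)⁻¹, inv_inv] at hH
  simp only [hLS]
  refine hH.trans ?_
  gcongr
  calc _ ≤ ∫⁻ q, C * L' q ∂μ := lintegral_mono e3
    _ = C * ∫⁻ q, L' q ∂μ := lintegral_const_mul _ hL'
    _ ≤ C * 1 := by gcongr
    _ = C := mul_one C

namespace QueryAlgorithm

variable (A : QueryAlgorithm d T Ξ)

theorem likelihood_rpow_le (ξ : Ξ) (c : ℝ) (k : ℕ) (hk : k ≤ T) (s : ℝ) {p τ : ℝ} (hp : 1 < p)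
    (θ : Sphere d) (W : Matrix (Fin d) (Fin d) ℝ)
    (hx : 1 - θ.1.ofLp ⬝ᵥ A.blind (c • W) ξ k hk *ᵥ θ.1.ofLp ≤ τ) :
    ENNReal.ofReal (A.likelihood ξ c k hk s θ.1.ofLp W) ^ p ≤
      ENNReal.ofReal (Real.exp ((p ^ 2 - p) * s ^ 2 / 2 * τ)) *
        ENNReal.ofReal (A.likelihood ξ c k hk (p * s) θ.1.ofLp W) := by
  have hpos : 0 ≤ A.likelihood ξ c k hk s θ.1.ofLp W := (Real.exp_pos _).le
  rw [ENNReal.ofReal_rpow_of_nonneg hpos (by linarith),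
    ← ENNReal.ofReal_mul (Real.exp_pos _).le, A.likelihood_rpow, mul_comm]
  refine ENNReal.ofReal_le_ofReal (mul_le_mul_of_nonneg_right ?_ (Real.exp_pos _).le)
  rw [Real.exp_le_exp, Sphere.dotProduct_self]
  generalize (θ.1.ofLp ⬝ᵥ A.blind (c • W) ξ k hk *ᵥ θ.1.ofLp) = t at hx
  have h2 : 0 ≤ (p ^ 2 - p) * s ^ 2 / 2 := by
    have : 0 ≤ p ^ 2 - p := by nlinarith
    positivity
  -- Here `1 - t² = 2(1 - t) - (1 - t)² ≤ 2τ`.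
  have h3 : (1 ^ 2 - t ^ 2) / 2 ≤ τ := by nlinarith [sq_nonneg (1 - t)]
  calc _ = (p ^ 2 - p) * s ^ 2 / 2 * ((1 ^ 2 - t ^ 2) / 2) := by ring
    _ ≤ _ := by gcongr

theorem measurable_likelihood_sphere (ξ : Ξ) (c : ℝ) (k : ℕ) (hk : k ≤ T) (s : ℝ) :
    Measurable fun q : Sphere d × Matrix (Fin d) (Fin d) ℝ =>
      ENNReal.ofReal (A.likelihood ξ c k hk s q.1.1.ofLp q.2) := by
  have h1 : Measurable fun q : Sphere d × Matrix (Fin d) (Fin d) ℝ => (q.1.1.ofLp, q.2) :=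
    (Sphere.measurable_ofLp.comp measurable_fst).prodMk measurable_snd
  have h2 := (A.measurable_likelihood ξ c k hk s).comp h1
  exact h2.ennreal_ofReal

theorem lintegral_spiked_history_le [NeZero d] (ξ : Ξ) (c : ℝ) (k : ℕ) (hk : k ≤ T) (s : ℝ)
    {p τ : ℝ} (hp : 1 < p)
    {S : Set (Sphere d × (Fin k → EuclideanSpace ℝ (Fin d) × EuclideanSpace ℝ (Fin d)))}
    (hS : MeasurableSet S)
    (hSτ : ∀ θ h, (θ, h) ∈ S →
      1 - θ.1.ofLp ⬝ᵥ residual k (fun i => (h i).1.ofLp) *ᵥ θ.1.ofLp ≤ τ) :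
    ∫⁻ θ, ∫⁻ W, S.indicator (fun _ => (1 : ENNReal))
        (θ, A.history (c • (W + s • vecMulVec θ.1.ofLp θ.1.ofLp)) ξ k hk) ∂goe d
        ∂uniformSphere d ≤
      ENNReal.ofReal (Real.exp ((p - 1) * s ^ 2 / 2 * τ)) *
        (∫⁻ θ, ∫⁻ W, S.indicator (fun _ => (1 : ENNReal)) (θ, A.history (c • W) ξ k hk) ∂goe d
          ∂uniformSphere d) ^ (1 - 1 / p) := by
  have hp0 : 0 < p := by linarith
  have hind : Measurable (S.indicator fun _ => (1 : ENNReal)) := measurable_const.indicator hS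
  have hrun : Measurable fun q : Sphere d × Matrix (Fin d) (Fin d) ℝ =>
      (q.1, A.history (c • q.2) ξ k hk) :=
    measurable_fst.prodMk ((A.measurable_history k hk).comp
      ((measurable_matrix_smul measurable_const measurable_snd).prodMk measurable_const))
  have hlik : ∀ s, Measurable fun q : Sphere d × Matrix (Fin d) (Fin d) ℝ =>
      ENNReal.ofReal (A.likelihood ξ c k hk s q.1.1.ofLp q.2) := fun s =>
    A.measurable_likelihood_sphere ξ c k hk s
  have hone : ∫⁻ q : Sphere d × Matrix (Fin d) (Fin d) ℝ,
      ENNReal.ofReal (A.likelihood ξ c k hk (p * s) q.1.1.ofLp q.2)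
        ∂(uniformSphere d).prod (goe d) ≤ 1 := by
    rw [lintegral_prod _ (hlik _).aemeasurable]
    simp only [A.lintegral_likelihood, lintegral_const, measure_univ, mul_one, le_refl]
  have hH := lintegral_indicator_mul_le ((uniformSphere d).prod (goe d)) hp (hrun hS) (hlik s)
    (hlik (p * s)) (ENNReal.ofReal (Real.exp ((p ^ 2 - p) * s ^ 2 / 2 * τ)))
    (fun q hq => A.likelihood_rpow_le ξ c k hk s hp q.1 q.2 (hSτ _ _ hq)) hone
  have hpre : ∀ q : Sphere d × Matrix (Fin d) (Fin d) ℝ,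
      ((fun q : Sphere d × Matrix (Fin d) (Fin d) ℝ =>
        (q.1, A.history (c • q.2) ξ k hk)) ⁻¹' S).indicator (fun _ => (1 : ENNReal)) q =
      S.indicator (fun _ => (1 : ENNReal)) (q.1, A.history (c • q.2) ξ k hk) := fun _ => rfl
  simp only [hpre] at hH
  have hf1 : Measurable fun q : Sphere d × Matrix (Fin d) (Fin d) ℝ =>
      S.indicator (fun _ => (1 : ENNReal)) (q.1, A.history (c • q.2) ξ k hk) := hind.comp hrun
  have hf2 := hf1.mul (hlik s)
  simp only [Pi.mul_def] at hf2
  rw [lintegral_prod _ hf1.aemeasurable, lintegral_prod _ hf2.aemeasurable,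
    ENNReal.ofReal_rpow_of_nonneg (Real.exp_pos _).le (by positivity), ← Real.exp_mul,
    show (p ^ 2 - p) * s ^ 2 / 2 * τ * (1 / p) = (p - 1) * s ^ 2 / 2 * τ by field_simp] at hH
  refine le_trans (le_of_eq (lintegral_congr fun θ => ?_)) hH
  exact A.lintegral_history_add_spike ξ c k hk s θ.1.ofLp
    (Φ := fun h => S.indicator (fun _ => (1 : ENNReal)) (θ, h))
    (hind.comp (measurable_const.prodMk measurable_id))

/-- The projection of `blindNext`, as a function of the history. -/
def residualNext (ξ : Ξ) (k : Fin (T + 1))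
    (h : Fin k → EuclideanSpace ℝ (Fin d) × EuclideanSpace ℝ (Fin d)) :
    Matrix (Fin d) (Fin d) ℝ :=
  deflate (residual k fun i => (h i).1.ofLp) (A.next k ξ h).1.ofLp

theorem residualNext_eq_residual (ξ : Ξ) (k : Fin (T + 1))
    (h : Fin k → EuclideanSpace ℝ (Fin d) × EuclideanSpace ℝ (Fin d)) :
    A.residualNext ξ k h = residual (k + 1) (Fin.snoc (α := fun _ => Fin d → ℝ)
      (fun i => (h i).1.ofLp) (A.next k ξ h).1.ofLp) := by
  simp [residualNext, residual]

theorem measurable_residualNext (ξ : Ξ) (k : Fin (T + 1)) : Measurable (A.residualNext ξ k) :=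
  measurable_deflate
    (measurable_residual k fun i => (WithLp.measurable_ofLp 2 (Fin d → ℝ)).comp
      (measurable_fst.comp (measurable_pi_apply i)))
    (Sphere.measurable_ofLp.comp
      ((A.measurable_next k).comp (measurable_const.prodMk measurable_id)))

/-- The spike has small overlap with the first `k` queries, and overlap at least `τ'` once the
vector of round `k` is added. -/
def jumpSet (ξ : Ξ) (k : Fin (T + 1)) (τ τ' : ℝ) :
    Set (Sphere d × (Fin k → EuclideanSpace ℝ (Fin d) × EuclideanSpace ℝ (Fin d))) :=
  {q | 1 - q.1.1.ofLp ⬝ᵥ residual k (fun i => (q.2 i).1.ofLp) *ᵥ q.1.1.ofLp < τ ∧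
    τ' ≤ 1 - q.1.1.ofLp ⬝ᵥ A.residualNext ξ k q.2 *ᵥ q.1.1.ofLp}

theorem measurableSet_jumpSet (ξ : Ξ) (k : Fin (T + 1)) (τ τ' : ℝ) :
    MeasurableSet (A.jumpSet ξ k τ τ') := by
  have hθ : Measurable fun q : Sphere d ×
      (Fin k → EuclideanSpace ℝ (Fin d) × EuclideanSpace ℝ (Fin d)) => q.1.1.ofLp :=
    Sphere.measurable_ofLp.comp measurable_fst
  have hr : Measurable fun q : Sphere d ×
      (Fin k → EuclideanSpace ℝ (Fin d) × EuclideanSpace ℝ (Fin d)) =>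
      residual k (fun i => (q.2 i).1.ofLp) :=
    measurable_residual k fun i => (WithLp.measurable_ofLp 2 (Fin d → ℝ)).comp
      (measurable_fst.comp ((measurable_pi_apply i).comp measurable_snd))
  have hn := (A.measurable_residualNext ξ k).comp
    (measurable_snd : Measurable fun q : Sphere d ×
      (Fin k → EuclideanSpace ℝ (Fin d) × EuclideanSpace ℝ (Fin d)) => q.2)
  exact (measurableSet_lt
    (measurable_const.sub (measurable_dotProduct hθ (measurable_mulVec hr hθ)))
      measurable_const).inter
    (measurableSet_le measurable_const
      (measurable_const.sub (measurable_dotProduct hθ (measurable_mulVec hn hθ))))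

/-- Since the history does not depend on `θ`, Fubini fixes it first; `θ` is then uniform relative to
a fixed family of `k + 1` vectors. -/
theorem lintegral_jumpSet_le [NeZero d] (ξ : Ξ) (k : Fin (T + 1)) (τ a : ℝ) {β : ℝ} (h0 : 0 ≤ β)
    (h1 : β < 1)
    (h : Sphere d → Matrix (Fin d) (Fin d) ℝ →
      (Fin k → EuclideanSpace ℝ (Fin d) × EuclideanSpace ℝ (Fin d)))
    (hh : ∀ θ θ' W, h θ W = h θ' W) (hm : ∀ θ, Measurable (h θ)) :
    ∫⁻ θ, ∫⁻ W, (A.jumpSet ξ k τ (2 * a / d)).indicator (fun _ => (1 : ENNReal)) (θ, h θ W) ∂goe d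
        ∂uniformSphere d ≤
      ENNReal.ofReal (Real.exp (-(β * a)) * (√(1 - β) ^ ((k : ℕ) + 1))⁻¹) := by
  have hd : 1 ≤ d := Nat.one_le_iff_ne_zero.2 (NeZero.ne d)
  have : Nonempty (Fin d) := ⟨0⟩
  obtain ⟨θ₀⟩ : Nonempty (Sphere d) :=
    (NormedSpace.sphere_nonempty.2 zero_le_one).to_subtype
  have e : ∀ θ W, h θ W = h θ₀ W := fun θ W => hh θ θ₀ W
  simp only [e]
  have hind : Measurable ((A.jumpSet ξ k τ (2 * a / d)).indicator fun _ => (1 : ENNReal)) :=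
    measurable_const.indicator (A.measurableSet_jumpSet ξ k τ _)
  rw [lintegral_lintegral_swap]
  · calc _ ≤ ∫⁻ _ : Matrix (Fin d) (Fin d) ℝ,
          ENNReal.ofReal (Real.exp (-(β * a)) * (√(1 - β) ^ ((k : ℕ) + 1))⁻¹) ∂goe d := by
          refine lintegral_mono fun W => ?_
          have hmeas : MeasurableSet {θ : Sphere d | (θ, h θ₀ W) ∈ A.jumpSet ξ k τ (2 * a / d)} :=
            (measurable_id.prodMk measurable_const) (A.measurableSet_jumpSet ξ k τ _)
          calc ∫⁻ θ, (A.jumpSet ξ k τ (2 * a / d)).indicator (fun _ => (1 : ENNReal)) (θ, h θ₀ W) ∂uniformSphere d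
              = uniformSphere d {θ | (θ, h θ₀ W) ∈ A.jumpSet ξ k τ (2 * a / d)} := by
                rw [← lintegral_indicator_one hmeas]; rfl
            _ ≤ _ := measure_mono (t := {θ | 2 * a / d ≤ 1 - θ.1.ofLp ⬝ᵥ residual (k + 1)
                  (Fin.snoc (α := fun _ => Fin d → ℝ) (fun i => (h θ₀ W i).1.ofLp)
                    (A.next k ξ (h θ₀ W)).1.ofLp) *ᵥ θ.1.ofLp}) fun θ hθ => by
                have := hθ.2
                rwa [residualNext_eq_residual] at this
            _ ≤ _ := uniformSphere_tail hd h0 h1 a _ _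
      _ = _ := by rw [lintegral_const, measure_univ, mul_one]
  · exact (hind.comp (measurable_fst.prodMk ((hm θ₀).comp measurable_snd))).aemeasurable

theorem sq_inner_vec_le (M : Matrix (Fin d) (Fin d) ℝ) (ξ : Ξ) (k : Fin (T + 1)) (θ : Sphere d) :
    (inner ℝ (A.vec M ξ k) (θ : EuclideanSpace ℝ (Fin d))) ^ 2 ≤
      1 - θ.1.ofLp ⬝ᵥ A.blindNext M ξ k *ᵥ θ.1.ofLp := by
  have hQ := A.isOrthProj_blind M ξ k (Nat.le_of_lt_succ k.2)
  have h := (hQ.deflate (A.vec M ξ k).ofLp).sq_dotProduct_le (θ := θ.1.ofLp)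
    (hQ.deflate_mulVec _) (Sphere.dotProduct_self _)
  rw [Sphere.dotProduct_self] at h
  refine le_trans (le_of_eq ?_) h
  rw [EuclideanSpace.inner_eq_star_dotProduct, dotProduct_comm]
  simp

/-- Descend from round `n` until the potential is below the previous threshold. In round `0` the
truncated `k - 1` is `0`, and the condition holds because the empty span gives potential `0 < τ 0`.
-/
theorem exists_mem_jumpSet (M : Matrix (Fin d) (Fin d) ℝ) (ξ : Ξ) (θ : Sphere d) {τ : ℕ → ℝ}
    (hτ : 0 < τ 0) (n : ℕ) (hn : n < T + 1)
    (h : τ n ≤ 1 - θ.1.ofLp ⬝ᵥ A.blindNext M ξ ⟨n, hn⟩ *ᵥ θ.1.ofLp) :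
    ∃ k : Fin (T + 1), (θ, A.history M ξ k (Nat.le_of_lt_succ k.2)) ∈
      A.jumpSet ξ k (τ (k - 1)) (τ k) := by
  induction n with
  | zero =>
    refine ⟨⟨0, hn⟩, ?_, h⟩
    simpa [residual, Sphere.dotProduct_self] using hτ
  | succ n ih =>
    by_cases h1 : τ n ≤ 1 - θ.1.ofLp ⬝ᵥ A.blindNext M ξ ⟨n, by lia⟩ *ᵥ θ.1.ofLp
    · exact ih _ h1
    · refine ⟨⟨n + 1, hn⟩, ?_, h⟩
      rw [not_le, ← A.blind_succ M ξ n (Nat.le_of_lt_succ hn)] at h1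
      exact h1

/-- In units of the unscaled `W`, the spike has strength `s = λ√d`. -/
theorem spiked_eq (hd : 1 ≤ d) (lam : ℝ) (θ : Fin d → ℝ) (W : Matrix (Fin d) (Fin d) ℝ) :
    lam • vecMulVec θ θ + (√d)⁻¹ • W = (√d)⁻¹ • (W + (lam * √d) • vecMulVec θ θ) := by
  have : √(d : ℝ) ≠ 0 := (Real.sqrt_pos.2 (by exact_mod_cast hd)).ne'
  rw [smul_add, smul_smul, add_comm]
  congr 2
  field_simp

/-- Thresholds for the overlap of the spike with the vectors seen so far. -/
def threshold (d : ℕ) (lam δ : ℝ) (k : ℕ) : ℝ :=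
  2 * ((2 * lam ^ 2 * growthConst δ lam) ^ k * (√(Real.log (1 / δ)) + 1) ^ 2) / d

theorem lintegral_jump_le [NeZero d] {lam δ : ℝ} (hl : 0 < lam) (hl2 : 1 < 2 * lam ^ 2)
    (h0 : 0 < δ) (h1 : δ < 1) (ξ : Ξ) (k : Fin (T + 1)) :
    ∫⁻ θ, ∫⁻ W, (A.jumpSet ξ k (threshold d lam δ (k - 1)) (threshold d lam δ k)).indicator (fun _ => (1 : ENNReal))
        (θ, A.history ((√d)⁻¹ • (W + (lam * √d) • vecMulVec θ.1.ofLp θ.1.ofLp)) ξ k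
          (Nat.le_of_lt_succ k.2)) ∂goe d ∂uniformSphere d ≤
      ENNReal.ofReal (if k = 0 then δ else δ ^ (k : ℕ)) := by
  obtain ⟨k, hk⟩ := k
  cases k with
  | zero =>
    obtain ⟨β, hβ0, hβ1, hβ⟩ := first_tail_le h0 h1
    -- The empty history is independent of the spike even under the spiked law.
    refine (A.lintegral_jumpSet_le ξ ⟨0, hk⟩ _ _ hβ0 hβ1 _ (fun _ _ _ => rfl)
      fun θ => measurable_const).trans (ENNReal.ofReal_le_ofReal ?_)
    simpa using hβ
  | succ k =>
    obtain ⟨β, hβ0, hβ1, hβ⟩ := later_tail_le hl hl2 h0 h1 k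
    have hd' : (0 : ℝ) < d := by exact_mod_cast Nat.pos_of_ne_zero (NeZero.ne d)
    -- The Hölder exponent is `p = 1 + 1/λ²`: with `s² = λ²d`, the cost exponent `(p - 1)s²τ/2`
    -- becomes `dτ/2`, free of `λ` apart from `τ`.
    have hp : 1 < 1 + 1 / lam ^ 2 := by
      have : 0 < 1 / lam ^ 2 := by positivity
      linarith
    have h2 := A.lintegral_spiked_history_le ξ (√d)⁻¹ (k + 1) (Nat.le_of_lt_succ hk)
      (lam * √d) hp (A.measurableSet_jumpSet ξ ⟨k + 1, hk⟩ (threshold d lam δ k)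
        (threshold d lam δ (k + 1))) fun θ h hθ => hθ.1.le
    have h3 := A.lintegral_jumpSet_le ξ ⟨k + 1, hk⟩ (threshold d lam δ k)
      ((2 * lam ^ 2 * growthConst δ lam) ^ (k + 1) * (√(Real.log (1 / δ)) + 1) ^ 2) hβ0 hβ1
      (fun _ W => A.history ((√d)⁻¹ • W) ξ (k + 1) (Nat.le_of_lt_succ hk)) (fun _ _ _ => rfl)
      fun _ => (A.measurable_history (k + 1) (Nat.le_of_lt_succ hk)).comp
        ((measurable_matrix_smul measurable_const measurable_id).prodMk measurable_const)
    have hexp : 1 - 1 / (1 + 1 / lam ^ 2) = 1 / (1 + lam ^ 2) := by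
      field_simp
      ring
    have harg : (1 + 1 / lam ^ 2 - 1) * (lam * √d) ^ 2 / 2 * threshold d lam δ k =
        (2 * lam ^ 2 * growthConst δ lam) ^ k * (√(Real.log (1 / δ)) + 1) ^ 2 := by
      rw [threshold, mul_pow, Real.sq_sqrt hd'.le]
      field_simp
      ring
    rw [hexp, harg] at h2
    refine h2.trans ((mul_le_mul_right (ENNReal.rpow_le_rpow h3 (by positivity)) _).trans ?_)
    rw [ENNReal.ofReal_rpow_of_nonneg (by positivity) (by positivity),
      ← ENNReal.ofReal_mul (Real.exp_pos _).le]
    refine ENNReal.ofReal_le_ofReal ?_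
    simpa using hβ

theorem measurableSet_jump (k : Fin (T + 1)) (τ τ' : ℝ) :
    MeasurableSet {q : Sphere d × Matrix (Fin d) (Fin d) ℝ × Ξ |
      (q.1, A.history q.2.1 q.2.2 k (Nat.le_of_lt_succ k.2)) ∈ A.jumpSet q.2.2 k τ τ'} := by
  have hθ : Measurable fun q : Sphere d × Matrix (Fin d) (Fin d) ℝ × Ξ => q.1.1.ofLp :=
    Sphere.measurable_ofLp.comp measurable_fst
  have hb := (A.measurable_blind k (Nat.le_of_lt_succ k.2)).comp
    (measurable_snd : Measurable fun q : Sphere d × Matrix (Fin d) (Fin d) ℝ × Ξ => q.2)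
  have hn := (A.measurable_blindNext k).comp
    (measurable_snd : Measurable fun q : Sphere d × Matrix (Fin d) (Fin d) ℝ × Ξ => q.2)
  exact (measurableSet_lt
    (measurable_const.sub (measurable_dotProduct hθ (measurable_mulVec hb hθ)))
      measurable_const).inter
    (measurableSet_le measurable_const
      (measurable_const.sub (measurable_dotProduct hθ (measurable_mulVec hn hθ))))

/-- The seed is independent of the matrix, so the bound for each fixed seed is averaged.
Measurability in `θ` is recorded for exchanging sum and integral in the union bound. -/
theorem lintegral_spikedLaw_jump_le [NeZero d] {lam δ : ℝ} (hl : 0 < lam)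
    (hl2 : 1 < 2 * lam ^ 2) (h0 : 0 < δ) (h1 : δ < 1) (ν : Measure Ξ) [IsProbabilityMeasure ν]
    (k : Fin (T + 1)) :
    (Measurable fun θ => ((spikedLaw d lam θ).prod ν) {p |
      (θ, A.history p.1 p.2 k (Nat.le_of_lt_succ k.2)) ∈
        A.jumpSet p.2 k (threshold d lam δ (k - 1)) (threshold d lam δ k)}) ∧
    ∫⁻ θ, ((spikedLaw d lam θ).prod ν) {p | (θ, A.history p.1 p.2 k (Nat.le_of_lt_succ k.2)) ∈
        A.jumpSet p.2 k (threshold d lam δ (k - 1)) (threshold d lam δ k)} ∂uniformSphere d ≤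
      ENNReal.ofReal (if k = 0 then δ else δ ^ (k : ℕ)) := by
  have hd : 1 ≤ d := Nat.one_le_iff_ne_zero.2 (NeZero.ne d)
  set B := {q : Sphere d × Matrix (Fin d) (Fin d) ℝ × Ξ |
      (q.1, A.history q.2.1 q.2.2 k (Nat.le_of_lt_succ k.2)) ∈
        A.jumpSet q.2.2 k (threshold d lam δ (k - 1)) (threshold d lam δ k)} with hB
  have hBm : MeasurableSet B := A.measurableSet_jump k _ _
  have hBi : Measurable (B.indicator fun _ => (1 : ENNReal)) := measurable_const.indicator hBm
  have hmap : Measurable fun q : Sphere d × Matrix (Fin d) (Fin d) ℝ =>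
      lam • vecMulVec q.1.1.ofLp q.1.1.ofLp + (√d)⁻¹ • q.2 :=
    measurable_matrix_add (measurable_matrix_smul measurable_const
      (measurable_vecMulVec (Sphere.measurable_ofLp.comp measurable_fst)
        (Sphere.measurable_ofLp.comp measurable_fst)))
      (measurable_matrix_smul measurable_const measurable_snd)
  have hmapθ : ∀ θ : Sphere d, Measurable fun W : Matrix (Fin d) (Fin d) ℝ =>
      lam • vecMulVec θ.1.ofLp θ.1.ofLp + (√d)⁻¹ • W := fun θ =>
    hmap.comp (measurable_const.prodMk measurable_id)
  have hjoint : Measurable fun q : (Sphere d × Ξ) × Matrix (Fin d) (Fin d) ℝ =>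
      B.indicator (fun _ => (1 : ENNReal))
        (q.1.1, lam • vecMulVec q.1.1.1.ofLp q.1.1.1.ofLp + (√d)⁻¹ • q.2, q.1.2) :=
    hBi.comp ((measurable_fst.comp measurable_fst).prodMk
      ((hmap.comp ((measurable_fst.comp measurable_fst).prodMk measurable_snd)).prodMk
        (measurable_snd.comp measurable_fst)))
  have hθ : ∀ θ : Sphere d, ((spikedLaw d lam θ).prod ν) {p |
      (θ, A.history p.1 p.2 k (Nat.le_of_lt_succ k.2)) ∈
        A.jumpSet p.2 k (threshold d lam δ (k - 1)) (threshold d lam δ k)} =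
      ∫⁻ ξ, ∫⁻ W, B.indicator (fun _ => (1 : ENNReal))
        (θ, lam • vecMulVec θ.1.ofLp θ.1.ofLp + (√d)⁻¹ • W, ξ) ∂goe d ∂ν := by
    intro θ
    have : IsProbabilityMeasure (spikedLaw d lam θ) :=
      Measure.isProbabilityMeasure_map (hmapθ θ).aemeasurable
    have hsec : MeasurableSet {p : Matrix (Fin d) (Fin d) ℝ × Ξ | (θ, p) ∈ B} :=
      (measurable_const.prodMk measurable_id) hBm
    change ((spikedLaw d lam θ).prod ν) {p | (θ, p) ∈ B} = _
    rw [Measure.prod_apply_symm hsec]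
    refine lintegral_congr fun ξ => ?_
    have hsec2 : MeasurableSet {M : Matrix (Fin d) (Fin d) ℝ | (θ, M, ξ) ∈ B} :=
      (measurable_const.prodMk (measurable_id.prodMk measurable_const)) hBm
    change spikedLaw d lam θ {M | (θ, M, ξ) ∈ B} = _
    rw [spikedLaw, Measure.map_apply (hmapθ θ) hsec2, ← lintegral_indicator_one (hmapθ θ hsec2)]
    rfl
  simp only [hθ]
  refine ⟨hjoint.lintegral_prod_right'.lintegral_prod_right', ?_⟩
  rw [lintegral_lintegral_swap]
  · calc _ ≤ ∫⁻ _ : Ξ, ENNReal.ofReal (if k = 0 then δ else δ ^ (k : ℕ)) ∂ν := by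
          refine lintegral_mono fun ξ => ?_
          refine le_trans (le_of_eq ?_) (A.lintegral_jump_le hl hl2 h0 h1 ξ k)
          refine lintegral_congr fun θ => lintegral_congr fun W => ?_
          rw [spiked_eq hd]
          rfl
      _ = _ := by rw [lintegral_const, measure_univ, mul_one]
  · exact (hjoint.lintegral_prod_right').aemeasurable

theorem lintegral_spikedLaw_overlap_le (hd : 1 ≤ d) {lam δ : ℝ} (hl : 0 < lam)
    (hl2 : 1 < 2 * lam ^ 2) (h0 : 0 < δ) (h1 : δ < 1) (ν : Measure Ξ) [IsProbabilityMeasure ν] :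
    ∫⁻ θ : Sphere d, ((spikedLaw d lam θ).prod ν)
        {p : Matrix (Fin d) (Fin d) ℝ × Ξ | ∃ k : Fin (T + 1),
          (inner ℝ (A.vec p.1 p.2 k) (θ : EuclideanSpace ℝ (Fin d))) ^ 2 ≥
            (2 * lam ^ 2 * growthConst δ lam) ^ (k : ℕ) *
              (2 * (√(Real.log (1 / δ)) + 1) ^ 2 / (d : ℝ))} ∂uniformSphere d ≤
      ENNReal.ofReal (2 * δ / (1 - δ)) := by
  have : NeZero d := ⟨by lia⟩
  have hd' : (0 : ℝ) < d := by exact_mod_cast hd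
  have hτ0 : 0 < threshold d lam δ 0 := by
    have : 0 ≤ √(Real.log (1 / δ)) := Real.sqrt_nonneg _
    rw [threshold]
    positivity
  have hsub : ∀ θ : Sphere d, ((spikedLaw d lam θ).prod ν)
      {p : Matrix (Fin d) (Fin d) ℝ × Ξ | ∃ k : Fin (T + 1),
          (inner ℝ (A.vec p.1 p.2 k) (θ : EuclideanSpace ℝ (Fin d))) ^ 2 ≥
            (2 * lam ^ 2 * growthConst δ lam) ^ (k : ℕ) *
              (2 * (√(Real.log (1 / δ)) + 1) ^ 2 / (d : ℝ))} ≤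
      ∑ k : Fin (T + 1), ((spikedLaw d lam θ).prod ν)
        {p | (θ, A.history p.1 p.2 k (Nat.le_of_lt_succ k.2)) ∈
          A.jumpSet p.2 k (threshold d lam δ (k - 1)) (threshold d lam δ k)} := by
    intro θ
    refine (measure_mono ?_).trans (measure_iUnion_fintype_le _ _)
    rintro p ⟨k, hk⟩
    refine Set.mem_iUnion.2 (A.exists_mem_jumpSet p.1 p.2 θ hτ0 k k.2
      (le_trans (le_of_eq ?_) (hk.trans (A.sq_inner_vec_le p.1 p.2 k θ))))
    rw [threshold]
    ring
  refine (lintegral_mono hsub).trans ?_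
  rw [lintegral_finsetSum']
  · refine (Finset.sum_le_sum fun k _ =>
      (A.lintegral_spikedLaw_jump_le hl hl2 h0 h1 ν k).2).trans ?_
    rw [← ENNReal.ofReal_sum_of_nonneg fun k _ => by split_ifs <;> positivity,
      Fin.sum_univ_succ]
    refine ENNReal.ofReal_le_ofReal ?_
    simpa using sum_first_add_geometric_le h0 h1 T
  · exact fun k _ => (A.lintegral_spikedLaw_jump_le hl hl2 h0 h1 ν k).1.aemeasurable

end QueryAlgorithm

end Main

end SpikedQuery

end

theorem mainTheorem7 :
    (∀ (d T : ℕ), 1 ≤ d → ∀ lam : ℝ, 0 < lam → 1 < 2 * lam ^ 2 →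
      ∀ δ : ℝ, 0 < δ → δ < 1 →
      ∀ (Ξ : Type*) [MeasurableSpace Ξ] (ν : Measure Ξ) [IsProbabilityMeasure ν]
      (A : SpikedQuery.QueryAlgorithm d T Ξ),
      ∫⁻ θ : SpikedQuery.Sphere d,
        ((SpikedQuery.spikedLaw d lam θ).prod ν)
          {p : Matrix (Fin d) (Fin d) ℝ × Ξ | ∃ k : Fin (T + 1),
            (inner ℝ (A.vec p.1 p.2 k) (θ : EuclideanSpace ℝ (Fin d))) ^ 2 ≥
              (2 * lam ^ 2 * SpikedQuery.growthConst δ lam) ^ (k : ℕ) *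
                (2 * (Real.sqrt (Real.log (1 / δ)) + 1) ^ 2 / (d : ℝ))}
        ∂(SpikedQuery.uniformSphere d)
      ≤ ENNReal.ofReal (2 * δ / (1 - δ))) ∧
    (∃ r : ℝ → ℝ, Tendsto r (𝓝[>] 0) (𝓝 0) ∧
      (fun p : ℝ × ℝ => SpikedQuery.growthConst p.1 p.2 - 1 - r p.1)
        =o[(𝓝[>] 0) ×ˢ atTop] (fun p : ℝ × ℝ => 1 / p.2)) :=
  ⟨fun _ _ hd _ hl hl2 _ h0 h1 _ _ ν _ A =>
    A.lintegral_spikedLaw_overlap_le hd hl hl2 h0 h1 ν, SpikedQuery.growthConst_expansion⟩
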